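/- Let $K \ge 2$ half-duplex relays assist a transmitter to communicate with a receiver, without a direct link. Let $h_k$ be the gain from the transmitter to relay $k$, $g_k$ the gain from relay $k$ to the receiver, and $i_{(k)}$ the gain from relay $(k)$ to relay $k$, where $(k)$ is the cyclic predecessor of $k$. The $3K$ gains are independent, zero-mean circularly symmetric complex Gaussian with positive variances (Rayleigh fading) and are constant during a block; every noise sample is independent $\mathcal{CN}(0,1)$, and every node has power constraint $P$. The modified switching Markovian (SM) scheme with $N\ge 1$ sub-blocks uses $NK+1$ slots. The transmitter sends symbols $x_{n,k}$ ($1\le n\le N$, $1\le k\le K$) in the first $NK$ slots, in lexicographic order. Relay $k$ listens in slot $(n-1)K+k$, where it hears the transmitter through $h_k$ and relay $(k)$, which is then transmitting, through $i_{(k)}$ (no relay transmits in the first slot); in the next slot it forwards the received signal multiplied by $$\alpha_k=\min\Big\{1,\frac{P}{P(|h_k|^2+|i_{(k)}|^2)+1}\Big\},$$ and it is silent in all other slots. The receiver listens in the last $NK$ slots. Then no relay transmits while it listens, and for a Gaussian codebook of power $P$ the average transmit power of every relay is at most $P$. For all gains the end-to-end channel is the $NK\times NK$ MIMO channel $$\mathbf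 y=\mathbf H_T\mathbf x+(\mathbf G\mathbf\Omega\mathbf F\,\mathbf n+\mathbf z),\qquad \mathbf H_T=\mathbf G\mathbf\Omega\mathbf F\mathbf H,$$ with $\mathbf G=\mathbf I_N\otimes\mathrm{diag}(g_k)$, $\mathbf\Omega=\mathbf I_N\otimes\mathrm{diag}(\alpha_k)$, $\mathbf H=\mathbf I_N\otimes\mathrm{diag}(h_k)$ and $\mathbf F$ the lower triangular matrix with unit diagonal whose entry $(a,b)$, $a>b$, is the product over $b<j\le a$ of $i_{(k_j)}\alpha_{(k_j)}$, $k_j$ being the relay that listens in slot $j$. Its matrix $\mathbf H_T$ is lower triangular and its noise is colored, with covariance $\mathbf P_n=\mathbf I+\mathbf G\mathbf\Omega\mathbf F\mathbf F^H\mathbf\Omega^H\mathbf G^H$. For multiplexing gain $r \ge 0$ let $$d_N(r)=\lim_{P\to\infty}-\frac{\log\Pr\{\log|\mathbf I+P\,\mathbf H_T\mathbf H_T^H\mathbf P_n^{-1}|\le (NK+1)\,r\log P\}}{\log P}$$ be the diversity gain of the scheme, and let $$d_{opt}(r)=\lim_{P\to\infty}-\frac{\log\Pr\{\log(1+P\sum_k|h_k|^2)\le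 r\log P\}}{\log P}$$ be the diversity gain of the cut between the transmitter and the relays (the cut-set bound), with $-\log 0=\infty$. Both limits exist in $[0,\infty]$, $d_N(r)\le d_{opt}(r)$, and $$d_N(r)\ge\max\Big\{0,\;K(1-r)-\frac rN\Big\}.$$ Moreover $d_{opt}(r)=K(1-r)$ for $0<r\le 1$, and $d_N(r)\to d_{opt}(r)$ as $N\to\infty$ for every $r\ge0$; for $0\le r\le1$ the lower bound also tends to $K(1-r)$. -/

import Mathlib

open MeasureTheory ProbabilityTheory Filter Topology
open scoped NNReal ENNReal Matrix

noncomputable section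

/-- The circularly symmetric complex Gaussian law `CN(0, v)`: independent real and imaginary parts,
each of variance `v / 2`. -/
def complexNormal (v : ℝ≥0) : Measure ℂ :=
  ((gaussianReal 0 (v / 2)).prod (gaussianReal 0 (v / 2))).map (fun p => Complex.mk p.1 p.2)

/-- The channel gains during one block of transmission: `h k` from the transmitter to relay `k`,
`g k` from relay `k` to the receiver, and `i (prevRelay k)` from relay `prevRelay k` to relay `k`.
There is no direct link from the transmitter to the receiver. -/
structure Gains (K : ℕ) where
  h : Fin K → ℂ
  g : Fin K → ℂ
  i : Fin K → ℂ

/-- The cyclic predecessor of relay `k`. -/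
def prevRelay {K : ℕ} (k : Fin K) : Fin K := ⟨(k.val + K - 1) % K, Nat.mod_lt _ k.pos⟩

/-- The amplification coefficient of relay `k`, capped at `1`. -/
def amplification {K : ℕ} (c : Gains K) (P : ℝ) (k : Fin K) : ℝ :=
  min 1 (P / (P * (‖c.h k‖ ^ 2 + ‖c.i (prevRelay k)‖ ^ 2) + 1))

/-- The signal transmitted by relay `k` in slot `s` (slots are numbered from `0`, and one symbol per
slot is described; the symbols of a slot are treated alike), when the transmitter sends `x` in the
slots `0, …, L - 1` and `n s` is the noise at the relay that listens in slot `s`.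
In slot `s < L` the relay `k` with `k ≡ s mod K` listens; it hears the transmitter and the
preceding relay, which is the one transmitting in that slot. In slot `s + 1` it forwards the amplified
signal. In all other slots a relay is silent. -/
def relaySignal {K L : ℕ} (c : Gains K) (P : ℝ) (x n : Fin L → ℂ) : ℕ → Fin K → ℂ
  | 0, _ => 0
  | s + 1, k =>
    if hs : s < L ∧ s % K = k.val then
      (amplification c P k : ℂ) *
        (c.h k * x ⟨s, hs.1⟩ + c.i (prevRelay k) * relaySignal c P x n s (prevRelay k)
          + n ⟨s, hs.1⟩)
    else 0

/-- The signals at the receiver: entry `m` is the signal received in slot `m + 1`, with noise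
`z m`. -/
def receiverSignal {K L : ℕ} (c : Gains K) (P : ℝ) (x n z : Fin L → ℂ) (m : Fin L) : ℂ :=
  ∑ k : Fin K, c.g k * relaySignal c P x n (m.val + 1) k + z m

/-- `I_N ⊗ diag(v_1, …, v_K)`, with rows and columns numbered by the slots. -/
def slotDiagonal (N : ℕ) {K : ℕ} (v : Fin K → ℂ) : Matrix (Fin (N * K)) (Fin (N * K)) ℂ :=
  Matrix.diagonal (fun m => v m.modNat)

/-- The lower triangular matrix `F`, with unit diagonal, that describes the propagation through the
chain of relays: passing from the relay listening in slot `j - 1` to the one listening in slot `j`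
multiplies a signal by the amplification of the former and by the gain of the link. -/
def propagation (N : ℕ) {K : ℕ} (c : Gains K) (P : ℝ) :
    Matrix (Fin (N * K)) (Fin (N * K)) ℂ :=
  Matrix.of fun a b =>
    if b ≤ a then
      ∏ j ∈ Finset.Ioc b a,
        c.i (prevRelay j.modNat) * (amplification c P (prevRelay j.modNat) : ℂ)
    else 0

/-- `G Ω F`: the matrix through which the noise of the relays reaches the receiver. -/
def relayMatrix (N : ℕ) {K : ℕ} (c : Gains K) (P : ℝ) : Matrix (Fin (N * K)) (Fin (N * K)) ℂ :=
  slotDiagonal N c.g * slotDiagonal N (fun k => (amplification c P k : ℂ)) * propagation N c P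

/-- The end-to-end channel matrix `H_T = G Ω F H`. -/
def channelMatrix (N : ℕ) {K : ℕ} (c : Gains K) (P : ℝ) : Matrix (Fin (N * K)) (Fin (N * K)) ℂ :=
  relayMatrix N c P * slotDiagonal N c.h

/-- The covariance matrix `I + G Ω F Fᴴ Ωᴴ Gᴴ` of the end-to-end noise. -/
def noiseCovariance (N : ℕ) {K : ℕ} (c : Gains K) (P : ℝ) :
    Matrix (Fin (N * K)) (Fin (N * K)) ℂ :=
  1 + relayMatrix N c P * (relayMatrix N c P)ᴴ

/-- `log |I + P H_T H_Tᴴ P_n⁻¹|`; the determinant is a positive real number. -/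
def mutualInformation (N : ℕ) {K : ℕ} (c : Gains K) (P : ℝ) : ℝ :=
  Real.log (1 + (P : ℂ) • (channelMatrix N c P * (channelMatrix N c P)ᴴ
    * (noiseCovariance N c P)⁻¹)).det.re

/-- The law of `L` independent `CN(0, v)` symbols. -/
def iidNormal (L : ℕ) (v : ℝ≥0) : Measure (Fin L → ℂ) :=
  Measure.pi fun _ => complexNormal v

/-- The gains at the outcome `ω`. -/
def gainsAt {Ω : Type*} {K : ℕ} (h g i : Fin K → Ω → ℂ) (ω : Ω) : Gains K :=
  ⟨fun k => h k ω, fun k => g k ω, fun k => i k ω⟩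

/-- The probability that the scheme, which takes `N K + 1` slots, is in outage from the rate
`r log P` at power `P`. -/
def outageProbability {Ω : Type*} [MeasurableSpace Ω] (μ : Measure Ω) {K : ℕ}
    (h g i : Fin K → Ω → ℂ) (N : ℕ) (r P : ℝ) : ℝ≥0∞ :=
  μ {ω | mutualInformation N (gainsAt h g i ω) P ≤ ((N * K : ℕ) + 1 : ℝ) * r * Real.log P}

/-- The probability that the cut between the transmitter and the `K` relays, a `1 × K` channel, is in
outage from the rate `r log P` at power `P`. -/
def cutSetOutageProbability {Ω : Type*} [MeasurableSpace Ω] (μ : Measure Ω) {K : ℕ}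
    (h : Fin K → Ω → ℂ) (r P : ℝ) : ℝ≥0∞ :=
  μ {ω | Real.log (1 + P * ∑ k, ‖h k ω‖ ^ 2) ≤ r * Real.log P}

/-- `d = lim_{P → ∞} - log p(P) / log P`, where `log 0 = -∞`. -/
def HasDiversityGain (p : ℝ → ℝ≥0∞) (d : EReal) : Prop :=
  Tendsto (fun P : ℝ => -(ENNReal.log (p P)) / ((Real.log P : ℝ) : EReal)) atTop (𝓝 d)

end

/-!
The end-to-end channel is that of a first-order Gauss-Markov chain: the signal heard in a slot is a
scaled copy of the one heard in the slot before plus a fresh input, and the receiver observes it in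
noise. Eliminating the slots one after the other (`det_outputCov`) shows that the determinants in the
mutual information are values of the linear recursion `chain`, whose coefficients are the squared norms of
the gains. This recursion has no subtractions. Hence, if each power gain is written as `P ^ (-x j)`, the
mutual information is `log P` times a continuous piecewise linear function `rateExponent` of the exponents
`x`, up to an error that is bounded uniformly in the gains (`mutualInformation_approx`).

The diversity gain is then a large deviation rate (`hasDiversityGain_sInf`). The power gains are
independent; near `0` their laws are comparable to Lebesgue measure, and their tails decay faster than
every power. So exponents near `x ≥ 0` occur with probability `P ^ (-∑ x j)` up to constants, and
conversely Markov's inequality for the product of the negative moments of order `s < 1` bounds the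
probability of a large sum of exponents. An outage has the exponent `min {∑ x j | x ≥ 0, φ x ≤ c}`,
where `φ` is `rateExponent` for the scheme and `cutExponent` for the cut. The limit exists because `φ`
decreases strictly, as long as it is positive, when the exponents of the first hop grow
(`tropChain_shift`), so that strict and weak inequality in the constraint give the same infimum. For
multiplexing gain `0` an outage has probability `0` and both diversity gains are infinite.

One term of the max-plus polynomial describes `N K` two-hop paths without interference; it gives
`N * ∑ k, (1 - x_h k - x_g k) ≤ rateExponent`, and with it the lower bound `K (1 - r) - r / N`. The upper
bound holds at the level of events: the mutual information is at most `N K log (1 + P ∑ ‖h k‖ ^ 2)`, so that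
an outage of the cut is one of the scheme.
-/

/-! ### The forward recursion for the determinant of a chain -/

/-- The recursion of the innovations (Kalman) filter of the relay chain, cleared of denominators and
run for `L` steps from slot `m`: `u` is the determinant of the output covariance of the slots already
passed, and `v` is `u` times the variance of the state in the current slot given the outputs of those
slots. The state of slot `j` is observed with power gain `γ j`; it enters that of slot `j + 1` with power
gain `β (j + 1)`, where a fresh input of variance `Λ (j + 1)` is added. -/
def chain (Λ γ β : ℕ → ℝ) : ℕ → ℕ → ℝ → ℝ → ℝ
  | 0, _, u, _ => u
  | L + 1, m, u, v =>
    chain Λ γ β L (m + 1) (u + γ m * v) (Λ (m + 1) * (u + γ m * v) + β (m + 1) * v)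

/-- The max-plus counterpart of `chain`. -/
def tropChain (Λ γ β : ℕ → ℝ) : ℕ → ℕ → ℝ → ℝ → ℝ
  | 0, _, u, _ => u
  | L + 1, m, u, v =>
    tropChain Λ γ β L (m + 1) (max u (γ m + v))
      (max (Λ (m + 1) + max u (γ m + v)) (β (m + 1) + v))

lemma chain_smul (Λ γ β : ℕ → ℝ) (c : ℝ) (L m : ℕ) (u v : ℝ) :
    chain Λ γ β L m (c * u) (c * v) = c * chain Λ γ β L m u v := by
  induction L generalizing m u v with
  | zero => rfl
  | succ L ih =>
    simp only [chain]
    rw [← ih]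
    congr 1 <;> ring

lemma chain_mono {Λ Λ' γ β : ℕ → ℝ} (hΛ : ∀ m, 0 ≤ Λ m) (hΛ' : ∀ m, Λ m ≤ Λ' m)
    (hγ : ∀ m, 0 ≤ γ m) (hβ : ∀ m, 0 ≤ β m) (L m : ℕ) {u v u' v' : ℝ} (hu : 0 ≤ u) (hv : 0 ≤ v)
    (huu : u ≤ u') (hvv : v ≤ v') : chain Λ γ β L m u v ≤ chain Λ' γ β L m u' v' := by
  induction L generalizing m u v u' v' with
  | zero => exact huu
  | succ L ih =>
    have h1 : 0 ≤ u + γ m * v := add_nonneg hu (mul_nonneg (hγ m) hv)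
    have h2 : u + γ m * v ≤ u' + γ m * v' :=
      add_le_add huu (mul_le_mul_of_nonneg_left hvv (hγ m))
    refine ih (m + 1) h1 (add_nonneg (mul_nonneg (hΛ _) h1) (mul_nonneg (hβ _) hv)) h2 ?_
    exact add_le_add (mul_le_mul (hΛ' _) h2 h1 ((hΛ _).trans (hΛ' _)))
      (mul_le_mul_of_nonneg_left hvv (hβ _))

lemma chain_lt_of_lt {Λ γ β : ℕ → ℝ} (hΛ : ∀ m, 0 ≤ Λ m) (hγ : ∀ m, 0 ≤ γ m) (hβ : ∀ m, 0 ≤ β m)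
    (L m : ℕ) {u v u' v' : ℝ} (huu : u < u') (hvv : v ≤ v') :
    chain Λ γ β L m u v < chain Λ γ β L m u' v' := by
  induction L generalizing m u v u' v' with
  | zero => exact huu
  | succ L ih =>
    have h2 : u + γ m * v < u' + γ m * v' :=
      add_lt_add_of_lt_of_le huu (mul_le_mul_of_nonneg_left hvv (hγ m))
    exact ih (m + 1) h2 (add_le_add (mul_le_mul_of_nonneg_left h2.le (hΛ _))
      (mul_le_mul_of_nonneg_left hvv (hβ _)))

lemma le_chain {Λ γ β : ℕ → ℝ} (hΛ : ∀ m, 0 ≤ Λ m) (hγ : ∀ m, 0 ≤ γ m) (hβ : ∀ m, 0 ≤ β m)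
    (L m : ℕ) {u v : ℝ} (hu : 0 ≤ u) (hv : 0 ≤ v) : u ≤ chain Λ γ β L m u v := by
  induction L generalizing m u v with
  | zero => exact le_rfl
  | succ L ih =>
    have h1 : u ≤ u + γ m * v := le_add_of_nonneg_right (mul_nonneg (hγ m) hv)
    exact h1.trans (ih (m + 1) (hu.trans h1)
      (add_nonneg (mul_nonneg (hΛ _) (hu.trans h1)) (mul_nonneg (hβ _) hv)))

/-- Raising the input variances from `1` to at most `S` multiplies the determinant by at most
`S ^ L`. -/
lemma chain_le_pow_mul {Λ γ β : ℕ → ℝ} {S : ℝ} (hS : 1 ≤ S) (hΛ : ∀ m, 0 ≤ Λ m)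
    (hΛS : ∀ m, Λ m ≤ S) (hγ : ∀ m, 0 ≤ γ m) (hβ : ∀ m, 0 ≤ β m) (L m : ℕ) {u v : ℝ}
    (hu : 0 ≤ u) (hv : 0 ≤ v) :
    chain Λ γ β L m u (S * v) ≤ S ^ L * chain (fun _ => 1) γ β L m u v := by
  induction L generalizing m u v with
  | zero => simp [chain]
  | succ L ih =>
    have hS0 : 0 ≤ S := by linarith
    have hgv : 0 ≤ γ m * v := mul_nonneg (hγ m) hv
    have hu1 : 0 ≤ u + γ m * v := by linarith
    have hbv : 0 ≤ β (m + 1) * v := mul_nonneg (hβ _) hv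
    have key := ih (m + 1) (u := u + γ m * v) (v := 1 * (u + γ m * v) + β (m + 1) * v) hu1
      (by linarith)
    calc chain Λ γ β (L + 1) m u (S * v)
        ≤ chain Λ γ β L (m + 1) (S * (u + γ m * v))
            (S * (S * (1 * (u + γ m * v) + β (m + 1) * v))) := by
          have e : u + γ m * (S * v) ≤ S * (u + γ m * v) := by nlinarith
          have e0 : 0 ≤ u + γ m * (S * v) := by nlinarith [mul_nonneg hS0 hgv]
          refine chain_mono hΛ (fun _ => le_rfl) hγ hβ L (m + 1) e0 ?_ e ?_
          · exact add_nonneg (mul_nonneg (hΛ _) e0) (mul_nonneg (hβ _) (mul_nonneg hS0 hv))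
          · have e1 : Λ (m + 1) * (u + γ m * (S * v)) ≤ S * (S * (u + γ m * v)) :=
              mul_le_mul (hΛS _) e e0 hS0
            have e2 : β (m + 1) * (S * v) ≤ S * (S * (β (m + 1) * v)) := by
              nlinarith [mul_nonneg hS0 hbv]
            linarith
      _ = S * chain Λ γ β L (m + 1) (u + γ m * v)
            (S * (1 * (u + γ m * v) + β (m + 1) * v)) := chain_smul _ _ _ _ _ _ _ _
      _ ≤ S * (S ^ L * chain (fun _ => 1) γ β L (m + 1) (u + γ m * v)
            (1 * (u + γ m * v) + β (m + 1) * v)) := mul_le_mul_of_nonneg_left key hS0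
      _ = S ^ (L + 1) * chain (fun _ => 1) γ β (L + 1) m u v := by
          simp only [chain]; ring

lemma chain_one_lt {Λ γ β : ℕ → ℝ} (hΛ : ∀ m, 1 < Λ m) (hγ : ∀ m, 0 < γ m) (hβ : ∀ m, 0 ≤ β m)
    {L : ℕ} (hL : 0 < L) : chain (fun _ => 1) γ β L 0 1 1 < chain Λ γ β L 0 1 (Λ 0) := by
  obtain ⟨L, rfl⟩ := Nat.exists_eq_add_one_of_ne_zero hL.ne'
  have h1 : chain (fun _ => 1) γ β (L + 1) 0 1 1 < chain (fun _ => 1) γ β (L + 1) 0 1 (Λ 0) := by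
    have h2 : 1 + γ 0 * 1 < 1 + γ 0 * Λ 0 := by nlinarith [hγ 0, hΛ 0]
    refine chain_lt_of_lt (fun _ => zero_le_one) (fun m => (hγ m).le) hβ L 1 h2 ?_
    nlinarith [hβ 1, hΛ 0, mul_nonneg (hβ 1) (sub_nonneg.2 (hΛ 0).le)]
  exact h1.trans_le (chain_mono (fun _ => zero_le_one) (fun m => (hΛ m).le) (fun m => (hγ m).le) hβ
    _ _ zero_le_one (zero_le_one.trans (hΛ 0).le) le_rfl le_rfl)

/-! ### The max-plus recursion -/

lemma log_add_bounds {a b : ℝ} (ha : 0 < a) (hb : 0 < b) :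
    |Real.log (a + b) - max (Real.log a) (Real.log b)| ≤ Real.log 2 := by
  wlog h : b ≤ a generalizing a b
  · rw [add_comm, max_comm]; exact this hb ha (le_of_not_ge h)
  rw [max_eq_left (Real.log_le_log hb h)]
  have h1 : Real.log a ≤ Real.log (a + b) := Real.log_le_log ha (by linarith)
  have h2 : Real.log (a + b) ≤ Real.log (2 * a) := Real.log_le_log (by linarith) (by linarith)
  rw [Real.log_mul two_ne_zero ha.ne'] at h2
  rw [abs_le]
  constructor <;> linarith [Real.log_pos one_lt_two]

lemma log_add_approx {a b s t ℓ C : ℝ} (ha : 0 < a) (hb : 0 < b) (hℓ : 0 ≤ ℓ)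
    (h1 : |Real.log a - ℓ * s| ≤ C) (h2 : |Real.log b - ℓ * t| ≤ C) :
    |Real.log (a + b) - ℓ * max s t| ≤ C + Real.log 2 := by
  have h3 := log_add_bounds ha hb
  have h4 := abs_max_sub_max_le_max (Real.log a) (Real.log b) (ℓ * s) (ℓ * t)
  rw [← mul_max_of_nonneg _ _ hℓ] at h4
  have h5 : max |Real.log a - ℓ * s| |Real.log b - ℓ * t| ≤ C := max_le h1 h2
  calc _ = |(Real.log (a + b) - max (Real.log a) (Real.log b))
        + (max (Real.log a) (Real.log b) - ℓ * max s t)| := by congr 1; ring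
    _ ≤ _ := by linarith [abs_add_le (Real.log (a + b) - max (Real.log a) (Real.log b))
                  (max (Real.log a) (Real.log b) - ℓ * max s t)]

lemma log_mul_approx {a b s t ℓ C D : ℝ} (ha : 0 < a) (hb : 0 < b)
    (h1 : |Real.log a - ℓ * s| ≤ C) (h2 : |Real.log b - ℓ * t| ≤ D) :
    |Real.log (a * b) - ℓ * (s + t)| ≤ C + D := by
  rw [Real.log_mul ha.ne' hb.ne', show Real.log a + Real.log b - ℓ * (s + t)
    = (Real.log a - ℓ * s) + (Real.log b - ℓ * t) by ring]
  exact (abs_add_le _ _).trans (add_le_add h1 h2)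

/-- On a logarithmic scale the recursion is its max-plus counterpart, up to a bounded error: it has no
subtractions. -/
lemma log_chain_approx {Λ γ β Λ' γ' β' : ℕ → ℝ} {ℓ C : ℝ} (hℓ : 0 ≤ ℓ) (hΛ : ∀ m, 0 < Λ m)
    (hγ : ∀ m, 0 < γ m) (hβ : ∀ m, 0 < β m) (hΛ' : ∀ m, |Real.log (Λ m) - ℓ * Λ' m| ≤ C)
    (hγ' : ∀ m, |Real.log (γ m) - ℓ * γ' m| ≤ C) (hβ' : ∀ m, |Real.log (β m) - ℓ * β' m| ≤ C)
    (L m : ℕ) {u v u' v' D : ℝ} (hu : 0 < u) (hv : 0 < v) (huu : |Real.log u - ℓ * u'| ≤ D)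
    (hvv : |Real.log v - ℓ * v'| ≤ D) :
    |Real.log (chain Λ γ β L m u v) - ℓ * tropChain Λ' γ' β' L m u' v'|
      ≤ D + L * (2 * C + 2 * Real.log 2) := by
  induction L generalizing m u v u' v' D with
  | zero => simpa [chain, tropChain] using huu
  | succ L ih =>
    have hC : 0 ≤ C := (abs_nonneg _).trans (hΛ' 0)
    have hl2 : 0 < Real.log 2 := Real.log_pos one_lt_two
    have hgv := mul_pos (hγ m) hv
    have hU : 0 < u + γ m * v := by linarith
    have hLU := mul_pos (hΛ (m + 1)) hU
    have hbv := mul_pos (hβ (m + 1)) hv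
    have h1 : |Real.log (u + γ m * v) - ℓ * max u' (γ' m + v')| ≤ (C + D) + Real.log 2 :=
      log_add_approx hu hgv hℓ (huu.trans (by linarith)) (log_mul_approx (hγ m) hv (hγ' m) hvv)
    have h2 : |Real.log (Λ (m + 1) * (u + γ m * v) + β (m + 1) * v)
        - ℓ * max (Λ' (m + 1) + max u' (γ' m + v')) (β' (m + 1) + v')|
        ≤ (C + ((C + D) + Real.log 2)) + Real.log 2 :=
      log_add_approx hLU hbv hℓ (log_mul_approx (hΛ _) hU (hΛ' _) h1)
        ((log_mul_approx (hβ _) hv (hβ' _) hvv).trans (by linarith))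
    have h3 := ih (m + 1) hU (by linarith) (D := D + (2 * C + 2 * Real.log 2))
      (h1.trans (by linarith)) (h2.trans (by linarith))
    refine h3.trans (le_of_eq ?_)
    push_cast; ring

lemma continuous_tropChain {X : Type*} [TopologicalSpace X] {Λ γ β : X → ℕ → ℝ} {u v : X → ℝ}
    (hΛ : ∀ m, Continuous fun x => Λ x m) (hγ : ∀ m, Continuous fun x => γ x m)
    (hβ : ∀ m, Continuous fun x => β x m) (hu : Continuous u) (hv : Continuous v) (L m : ℕ) :
    Continuous fun x => tropChain (Λ x) (γ x) (β x) L m (u x) (v x) := by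
  induction L generalizing m u v with
  | zero => exact hu
  | succ L ih =>
    have h1 : Continuous fun x => max (u x) (γ x m + v x) := hu.max ((hγ m).add hv)
    exact ih h1 (((hΛ _).add h1).max ((hβ _).add hv)) (m + 1)

/-- Lowering all input exponents by `δ` (but not below `0`) lowers the output by `δ`, until the value
for zero exponents is reached: a monomial of the max-plus polynomial loses at least `δ` as soon as one of
its input exponents stays positive, and otherwise it is a monomial at zero exponents. -/
lemma tropChain_shift {Λ Λ' γ β : ℕ → ℝ} {δ : ℝ} (hΛ : ∀ m, 0 ≤ Λ m)
    (hΛ' : ∀ m, Λ' m ≤ max 0 (Λ m - δ)) (hδ : 0 ≤ δ) (L m : ℕ) {u v u' v' u₀ v₀ : ℝ}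
    (hu : u' ≤ max u₀ (u - δ)) (hv : v' ≤ max v₀ (v - δ)) (huu : u' ≤ u) (hvv : v' ≤ v) :
    tropChain Λ' γ β L m u' v'
      ≤ max (tropChain (fun _ => 0) γ β L m u₀ v₀) (tropChain Λ γ β L m u v - δ) := by
  induction L generalizing m u v u' v' u₀ v₀ with
  | zero => exact hu
  | succ L ih =>
    have hΛΛ : Λ' (m + 1) ≤ Λ (m + 1) := (hΛ' _).trans (max_le (hΛ _) (by linarith))
    have a1 : max u' (γ m + v') ≤ max u (γ m + v) := max_le_max huu (by linarith)
    have a2 : max u' (γ m + v') ≤ max (max u₀ (γ m + v₀)) (max u (γ m + v) - δ) := by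
      rcases le_max_iff.1 hu with h | h <;> rcases le_max_iff.1 hv with h' | h' <;> grind
    refine ih (m + 1) a2 ?_ a1 (max_le_max (by linarith) (by linarith))
    have b := hΛ (m + 1)
    refine max_le ?_ ?_
    · rcases le_max_iff.1 (hΛ' (m + 1)) with h | h
      · rcases le_max_iff.1 a2 with h' | h'
        · exact le_max_of_le_left (le_max_of_le_left (by linarith))
        · refine le_max_of_le_right ?_
          have := le_max_left (Λ (m + 1) + max u (γ m + v)) (β (m + 1) + v)
          linarith
      · refine le_max_of_le_right ?_
        have := le_max_left (Λ (m + 1) + max u (γ m + v)) (β (m + 1) + v)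
        linarith
    · rcases le_max_iff.1 hv with h | h
      · exact le_max_of_le_left (le_max_of_le_right (by linarith))
      · refine le_max_of_le_right ?_
        have := le_max_right (Λ (m + 1) + max u (γ m + v)) (β (m + 1) + v)
        linarith

/-- The term of the max-plus polynomial in which every input is observed directly. -/
lemma add_sum_le_tropChain (Λ γ β : ℕ → ℝ) (L m : ℕ) {u v : ℝ} (hv : Λ m + u ≤ v) :
    u + ∑ j ∈ Finset.range L, (γ (m + j) + Λ (m + j)) ≤ tropChain Λ γ β L m u v := by
  induction L generalizing m u v with
  | zero => simp [tropChain]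
  | succ L ih =>
    refine le_trans ?_ (ih (m + 1) (le_max_left _ _))
    have h1 : γ m + v ≤ max u (γ m + v) := le_max_right _ _
    rw [Finset.sum_range_succ']
    simp only [add_zero, add_assoc, add_comm 1] at *
    linarith

lemma tropChain_zero_nonpos {γ β : ℕ → ℝ} (hγ : ∀ m, γ m ≤ 0) (hβ : ∀ m, β m ≤ 0) (L m : ℕ)
    {u v : ℝ} (hu : u ≤ 0) (hv : v ≤ 0) : tropChain (fun _ => 0) γ β L m u v ≤ 0 := by
  induction L generalizing m u v with
  | zero => exact hu
  | succ L ih =>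
    have h1 : max u (γ m + v) ≤ 0 := max_le hu (by linarith [hγ m])
    exact ih (m + 1) h1 (max_le (by linarith) (by linarith [hβ (m + 1)]))

/-! ### The determinant of the output covariance of a chain -/

/-- The gain from slot `c` to slot `a` along a chain whose link into slot `j` has gain `b j`. -/
def pathGain (b : ℕ → ℂ) (a c : ℕ) : ℂ := if c ≤ a then ∏ j ∈ Finset.Ioc c a, b j else 0

lemma pathGain_self (b : ℕ → ℂ) (a : ℕ) : pathGain b a a = 1 := by simp [pathGain]

lemma pathGain_of_lt (b : ℕ → ℂ) {a c : ℕ} (h : a < c) : pathGain b a c = 0 := by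
  simp [pathGain, not_le.2 h]

lemma pathGain_step_left (b : ℕ → ℂ) {a c : ℕ} (h : c < a) :
    pathGain b a c = b (c + 1) * pathGain b a (c + 1) := by
  rw [pathGain, pathGain, if_pos h.le, if_pos (Nat.succ_le_of_lt h),
    ← Finset.prod_Ioc_consecutive b (Nat.le_succ c) (Nat.succ_le_of_lt h)]
  simp

lemma pathGain_step_right (b : ℕ → ℂ) {a c : ℕ} (h : c ≤ a) :
    pathGain b (a + 1) c = b (a + 1) * pathGain b a c := by
  rw [pathGain, pathGain, if_pos h, if_pos (h.trans (Nat.le_succ a)),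
    Finset.prod_Ioc_succ_top h, mul_comm]

/-- The covariance of the outputs `d j * s j + z j` in the slots `m, …, m + L - 1` of a chain whose
states obey `s (j + 1) = b (j + 1) * s j + w (j + 1)`, with `z j` of variance `1` and `w j` of variance
`Λ j`, the first state having the additional variance `t`. -/
def outputCov (d b : ℕ → ℂ) (Λ : ℕ → ℝ) (L m : ℕ) (t : ℝ) : Matrix (Fin L) (Fin L) ℂ :=
  Matrix.of fun p q => (if p = q then 1 else 0) + d (m + p) * star (d (m + q)) *
    ∑ c : Fin L, pathGain b (m + p) (m + c) * star (pathGain b (m + q) (m + c)) *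
      ((Λ (m + c) + if (c : ℕ) = 0 then t else 0 : ℝ) : ℂ)

lemma sum_mul_add_first {L : ℕ} (f : Fin (L + 1) → ℂ) (Λ : ℕ → ℝ) (t : ℝ) :
    ∑ c : Fin (L + 1), f c * ((Λ c + if (c : ℕ) = 0 then t else 0 : ℝ) : ℂ)
      = ∑ c : Fin (L + 1), f c * (Λ c : ℂ) + f 0 * t := by
  simp only [Fin.sum_univ_succ, Fin.val_zero, Fin.val_succ]
  simp
  ring

/-- One step of Gaussian elimination removes the first slot of the chain. -/
lemma det_outputCov_succ (d b : ℕ → ℂ) (Λ : ℕ → ℝ) (L m : ℕ) {t : ℝ} (ht : 0 ≤ Λ m + t) :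
    (outputCov d b Λ (L + 1) m t).det = ((1 + ‖d m‖ ^ 2 * (Λ m + t) : ℝ) : ℂ) *
      (outputCov d b Λ L (m + 1)
        (‖b (m + 1)‖ ^ 2 * (Λ m + t) / (1 + ‖d m‖ ^ 2 * (Λ m + t)))).det := by
  set s : ℝ := Λ m + t with hs
  set δ : ℝ := 1 + ‖d m‖ ^ 2 * s with hδ
  have hδ0 : (δ : ℂ) ≠ 0 := by
    have : 0 < δ := by positivity
    exact_mod_cast this.ne'
  have hdm : d m * star (d m) = ((‖d m‖ ^ 2 : ℝ) : ℂ) := by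
    simpa using Complex.mul_conj' (d m)
  have hbm : b (m + 1) * star (b (m + 1)) = ((‖b (m + 1)‖ ^ 2 : ℝ) : ℂ) := by
    simpa using Complex.mul_conj' (b (m + 1))
  have hδC : (δ : ℂ) = 1 + d m * star (d m) * s := by rw [hdm, hδ]; push_cast; ring
  set W := outputCov d b Λ (L + 1) m t with hW
  -- the first row
  have hrow : ∀ q : Fin (L + 1), W 0 q = (if 0 = q then 1 else 0)
      + d m * star (d (m + q)) * (star (pathGain b (m + q) m) * s) := by
    intro q
    simp only [hW, outputCov, Matrix.of_apply, Fin.val_zero, add_zero, Fin.sum_univ_succ,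
      pathGain_self, Fin.val_succ]
    rw [Finset.sum_eq_zero fun c _ => by rw [pathGain_of_lt b (by omega)]; simp]
    simp [hs]
  have hcol : ∀ p : Fin L, W p.succ 0
      = d (m + (p + 1)) * star (d m) * (pathGain b (m + (p + 1)) m * s) := by
    intro p
    simp only [hW, outputCov, Matrix.of_apply, Fin.val_zero, add_zero, Fin.sum_univ_succ,
      pathGain_self, Fin.val_succ]
    rw [Finset.sum_eq_zero fun c _ => by rw [pathGain_of_lt b (a := m) (by omega)]; simp]
    simp [hs, Fin.succ_ne_zero]
  let k : Fin (L + 1) → ℂ := Fin.cons 0 fun p => W p.succ 0 / δ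
  let B : Matrix (Fin (L + 1)) (Fin (L + 1)) ℂ := Matrix.of fun p q => W p q - k p * W 0 q
  have hW00 : W 0 0 = δ := by
    rw [hrow, hδC]; simp [pathGain_self]
  have hB0 : B 0 = W 0 := by ext q; simp [B, k]
  have hdet : W.det = B.det := by
    refine Matrix.det_eq_of_forall_row_eq_smul_add_const k 0 (by simp [k]) fun p q => ?_
    rw [hB0]; simp [B]
  rw [hdet, Matrix.det_succ_column_zero, Fin.sum_univ_succ, Finset.sum_eq_zero, add_zero]
  · rw [hB0, hW00]
    simp only [Fin.val_zero, pow_zero, one_mul, Fin.succAbove_zero]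
    congr 2
    ext p q
    obtain ⟨L, rfl⟩ : ∃ L', L = L' + 1 := ⟨L - 1, by have := p.pos; omega⟩
    have e1 : B p.succ q.succ = W p.succ q.succ - W p.succ 0 / δ * W 0 q.succ := by simp [B, k]
    rw [Matrix.submatrix_apply, e1, hcol, hrow]
    simp only [hW, outputCov, Matrix.of_apply]
    have e2 : ∀ c : Fin (L + 1), m + 1 + (c : ℕ) = m + (c + 1) := fun c => by ring
    simp only [e2]
    rw [sum_mul_add_first (fun c : Fin (L + 1) => pathGain b (m + (p + 1)) (m + (c + 1)) *
      star (pathGain b (m + (q + 1)) (m + (c + 1)))) (fun c => Λ (m + (c + 1)))]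
    rw [Fin.sum_univ_succ]
    simp only [Fin.val_succ, Fin.val_zero, add_zero, Fin.succ_inj, zero_add,
      (Fin.succ_ne_zero _).symm, if_false, Nat.succ_ne_zero, ← hs, if_true]
    rw [pathGain_step_left b (a := m + (p + 1)) (c := m) (by omega),
      pathGain_step_left b (a := m + (q + 1)) (c := m) (by omega), star_mul]
    push_cast
    have hb2 : ((‖b (m + 1)‖ : ℂ) ^ 2) = b (m + 1) * star (b (m + 1)) := by
      rw [hbm]; push_cast; rfl
    rw [hb2]
    set X := ∑ c : Fin (L + 1), pathGain b (m + (p + 1)) (m + (c + 1)) *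
      star (pathGain b (m + (q + 1)) (m + (c + 1))) * (Λ (m + (c + 1)) : ℂ)
    field_simp
    rw [hδC]
    ring
  · intro p _
    have : B p.succ 0 = 0 := by
      simp only [B, k, Matrix.of_apply, Fin.cons_succ, hW00]
      field_simp
      simp
    rw [this]; simp

/-- The determinant of the output covariance is computed by the forward recursion. -/
lemma det_outputCov (d b : ℕ → ℂ) {Λ : ℕ → ℝ} (hΛ : ∀ m, 0 ≤ Λ m) (L m : ℕ) {t : ℝ} (ht : 0 ≤ t) :
    (outputCov d b Λ L m t).det
      = (chain Λ (fun j => ‖d j‖ ^ 2) (fun j => ‖b j‖ ^ 2) L m 1 (Λ m + t) : ℝ) := by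
  induction L generalizing m t with
  | zero => simp [chain]
  | succ L ih =>
    have hs : 0 ≤ Λ m + t := add_nonneg (hΛ m) ht
    have hδ : 0 < 1 + ‖d m‖ ^ 2 * (Λ m + t) := by positivity
    rw [det_outputCov_succ d b Λ L m hs, ih (m + 1) (by positivity), ← Complex.ofReal_mul,
      ← chain_smul]
    congr 1
    simp only [chain]
    congr 1
    · ring
    · field_simp

/-! ### The channel matrix of the scheme -/

/-- The relay that listens in slot `m`. -/
def slotRelay {K : ℕ} (hK : 0 < K) (m : ℕ) : Fin K := ⟨m % K, Nat.mod_lt _ hK⟩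

/-- The gain of the link from the relay listening in slot `j - 1` to that listening in slot `j`,
amplification included. -/
noncomputable def linkGain {K : ℕ} (hK : 0 < K) (c : Gains K) (P : ℝ) (j : ℕ) : ℂ :=
  c.i (prevRelay (slotRelay hK j)) * (amplification c P (prevRelay (slotRelay hK j)) : ℂ)

/-- The gain of the link from the relay listening in slot `j` to the receiver, amplification
included. -/
noncomputable def outputGain {K : ℕ} (hK : 0 < K) (c : Gains K) (P : ℝ) (j : ℕ) : ℂ :=
  c.g (slotRelay hK j) * (amplification c P (slotRelay hK j) : ℂ)

lemma propagation_apply {N K : ℕ} (hK : 0 < K) (c : Gains K) (P : ℝ) (p q : Fin (N * K)) :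
    propagation N c P p q = pathGain (linkGain hK c P) p q := by
  simp only [propagation, pathGain, Matrix.of_apply, Fin.le_def]
  congr 1
  rw [← Fin.map_valEmbedding_Ioc, Finset.prod_map]
  rfl

lemma relayMatrix_apply {N K : ℕ} (hK : 0 < K) (c : Gains K) (P : ℝ) (p q : Fin (N * K)) :
    relayMatrix N c P p q = outputGain hK c P p * pathGain (linkGain hK c P) p q := by
  rw [relayMatrix, slotDiagonal, slotDiagonal, Matrix.diagonal_mul_diagonal, Matrix.diagonal_mul,
    propagation_apply hK]
  rfl

lemma channelMatrix_apply {N K : ℕ} (hK : 0 < K) (c : Gains K) (P : ℝ) (p q : Fin (N * K)) :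
    channelMatrix N c P p q = relayMatrix N c P p q * c.h (slotRelay hK q) := by
  rw [channelMatrix, slotDiagonal, Matrix.mul_diagonal]
  rfl

lemma mul_diagonal_mul_conjTranspose_apply {n : Type*} [Fintype n] [DecidableEq n]
    (M : Matrix n n ℂ) (v : n → ℂ) (p q : n) :
    (M * Matrix.diagonal v * Mᴴ) p q = ∑ r, M p r * v r * star (M q r) := by
  rw [Matrix.mul_apply]
  simp only [Matrix.mul_diagonal, Matrix.conjTranspose_apply]

lemma det_one_add_relayMatrix {N K : ℕ} (hK : 0 < K) (c : Gains K) (P : ℝ) {Λ : ℕ → ℝ}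
    (hΛ : ∀ m, 0 ≤ Λ m) :
    (1 + relayMatrix N c P * Matrix.diagonal (fun q : Fin (N * K) => (Λ q : ℂ))
        * (relayMatrix N c P)ᴴ).det
      = (chain Λ (fun j => ‖outputGain hK c P j‖ ^ 2) (fun j => ‖linkGain hK c P j‖ ^ 2)
          (N * K) 0 1 (Λ 0) : ℝ) := by
  have := det_outputCov (outputGain hK c P) (linkGain hK c P) hΛ (N * K) 0 le_rfl
  rw [add_zero] at this
  rw [← this]
  congr 1
  ext p q
  simp only [outputCov, Matrix.of_apply, Matrix.add_apply, Matrix.one_apply,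
    mul_diagonal_mul_conjTranspose_apply, relayMatrix_apply hK, zero_add, ite_self,
    add_zero, Finset.mul_sum]
  congr 1
  refine Finset.sum_congr rfl fun r _ => ?_
  rw [star_mul']
  ring

/-- The variances of the inputs of the chain: the signal of power `P` and the noise of the relay that
listens. -/
noncomputable def inputVar {K : ℕ} (hK : 0 < K) (c : Gains K) (P : ℝ) (j : ℕ) : ℝ :=
  1 + P * ‖c.h (slotRelay hK j)‖ ^ 2

lemma mutualInformation_eq {N K : ℕ} (hK : 0 < K) (c : Gains K) {P : ℝ} (hP : 0 ≤ P) :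
    mutualInformation N c P = Real.log
      (chain (inputVar hK c P) (fun j => ‖outputGain hK c P j‖ ^ 2)
          (fun j => ‖linkGain hK c P j‖ ^ 2) (N * K) 0 1 (inputVar hK c P 0) /
        chain (fun _ => 1) (fun j => ‖outputGain hK c P j‖ ^ 2)
          (fun j => ‖linkGain hK c P j‖ ^ 2) (N * K) 0 1 1) := by
  have hden : (noiseCovariance N c P).det = (chain (fun _ => 1)
      (fun j => ‖outputGain hK c P j‖ ^ 2) (fun j => ‖linkGain hK c P j‖ ^ 2) (N * K) 0 1 1 : ℝ) := by
    have := det_one_add_relayMatrix (N := N) hK c P (Λ := fun _ => 1) fun _ => zero_le_one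
    rw [← this, noiseCovariance]
    simp
  have hpos : 0 < chain (fun _ => 1) (fun j => ‖outputGain hK c P j‖ ^ 2)
      (fun j => ‖linkGain hK c P j‖ ^ 2) (N * K) 0 1 1 :=
    zero_lt_one.trans_le (le_chain (fun _ => zero_le_one) (fun _ => by positivity)
      (fun _ => by positivity) _ _ zero_le_one zero_le_one)
  have hunit : IsUnit (noiseCovariance N c P).det := by
    rw [hden]; exact isUnit_iff_ne_zero.2 (by exact_mod_cast hpos.ne')
  have hnum : noiseCovariance N c P + (P : ℂ) • (channelMatrix N c P * (channelMatrix N c P)ᴴ)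
      = 1 + relayMatrix N c P * Matrix.diagonal (fun q : Fin (N * K) => (inputVar hK c P q : ℂ))
        * (relayMatrix N c P)ᴴ := by
    ext p q
    rw [Matrix.add_apply, Matrix.add_apply, mul_diagonal_mul_conjTranspose_apply]
    simp only [noiseCovariance, Matrix.add_apply, Matrix.smul_apply, Matrix.mul_apply, Matrix.conjTranspose_apply, channelMatrix_apply hK, smul_eq_mul,
      Finset.mul_sum, inputVar]
    rw [add_assoc, ← Finset.sum_add_distrib]
    congr 1
    refine Finset.sum_congr rfl fun r _ => ?_
    have : c.h (slotRelay hK r) * star (c.h (slotRelay hK r))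
        = ((‖c.h (slotRelay hK r)‖ ^ 2 : ℝ) : ℂ) := by
      simpa using Complex.mul_conj' (c.h (slotRelay hK r))
    rw [star_mul']
    push_cast at this ⊢
    linear_combination (P : ℂ) * relayMatrix N c P p r * star (relayMatrix N c P q r) * this
  rw [mutualInformation]
  congr 1
  have h1 : 1 + (P : ℂ) • (channelMatrix N c P * (channelMatrix N c P)ᴴ * (noiseCovariance N c P)⁻¹)
      = (noiseCovariance N c P + (P : ℂ) • (channelMatrix N c P * (channelMatrix N c P)ᴴ))
        * (noiseCovariance N c P)⁻¹ := by
    rw [add_mul, Matrix.mul_nonsing_inv _ hunit, smul_mul_assoc]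
  rw [h1, Matrix.det_mul, hnum, det_one_add_relayMatrix hK c P
    (fun m => by rw [inputVar]; positivity), Matrix.det_nonsing_inv, Ring.inverse_eq_inv', hden,
    ← Complex.ofReal_inv, ← Complex.ofReal_mul, Complex.ofReal_re, div_eq_mul_inv]

lemma slotRelay_succ_prev {K : ℕ} (hK : 0 < K) (m : ℕ) :
    prevRelay (slotRelay hK (m + 1)) = slotRelay hK m := by
  ext
  simp only [prevRelay, slotRelay]
  rw [Nat.add_sub_assoc hK, Nat.mod_add_mod, show m + 1 + (K - 1) = m + K by omega,
    Nat.add_mod_right]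

/-- The signal of the relay that listened in slot `m`. -/
lemma relaySignal_eq {N K : ℕ} (hK : 0 < K) (c : Gains K) (P : ℝ) (x n : Fin (N * K) → ℂ) (m : ℕ)
    (hm : m < N * K) :
    relaySignal c P x n (m + 1) (slotRelay hK m) = (amplification c P (slotRelay hK m) : ℂ) *
      ∑ q : Fin (N * K), pathGain (linkGain hK c P) m q * (c.h (slotRelay hK q) * x q + n q) := by
  induction m with
  | zero =>
    have h0 : 0 % K = (slotRelay hK 0).val := rfl
    simp only [relaySignal, hm, h0, and_self, dif_pos]
    rw [Finset.sum_eq_single (⟨0, hm⟩ : Fin (N * K))]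
    · simp [pathGain_self]
    · intro q _ hq
      rw [pathGain_of_lt _ (Nat.pos_of_ne_zero fun h => hq (Fin.ext h)), zero_mul]
    · simp
  | succ m ih =>
    have h0 : (m + 1) % K = (slotRelay hK (m + 1)).val := rfl
    rw [relaySignal, dif_pos ⟨hm, h0⟩, slotRelay_succ_prev, ih (by omega)]
    congr 1
    have h1 : ∀ q : Fin (N * K), pathGain (linkGain hK c P) (m + 1) q
        = (if q = ⟨m + 1, hm⟩ then 1 else 0)
          + linkGain hK c P (m + 1) * pathGain (linkGain hK c P) m q := by
      intro q
      rcases lt_trichotomy (q : ℕ) (m + 1) with h | h | h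
      · rw [pathGain_step_right _ (by omega), if_neg (by rintro rfl; simp at h), zero_add]
      · rw [h, pathGain_self, pathGain_of_lt _ (by omega), if_pos (Fin.ext h), mul_zero, add_zero]
      · rw [pathGain_of_lt _ h, pathGain_of_lt _ (by omega), if_neg (by rintro rfl; simp at h),
          mul_zero, add_zero]
    simp only [h1, add_mul, Finset.sum_add_distrib, ite_mul, one_mul, zero_mul,
      Finset.sum_ite_eq', Finset.mem_univ, if_true, mul_assoc, ← Finset.mul_sum]
    rw [linkGain, slotRelay_succ_prev]
    ring

lemma relaySignal_eq_zero_of_ne {K L : ℕ} (c : Gains K) (P : ℝ) (x n : Fin L → ℂ) {m : ℕ}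
    {k : Fin K} (h : m % K ≠ k) : relaySignal c P x n (m + 1) k = 0 := by
  rw [relaySignal, dif_neg fun hs => h hs.2]

lemma relaySignal_listening {K L : ℕ} (hK : 2 ≤ K) (c : Gains K) (P : ℝ) (x n : Fin L → ℂ) {s : ℕ}
    {k : Fin K} (h : s % K = k) : relaySignal c P x n s k = 0 := by
  cases s with
  | zero => rfl
  | succ m =>
    refine relaySignal_eq_zero_of_ne c P x n fun h' => ?_
    rw [← h'] at h
    have := (Nat.modEq_iff_dvd' (Nat.le_succ m)).1 (h.symm : m ≡ m + 1 [MOD K])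
    rw [show m.succ - m = 1 by omega] at this
    have := Nat.le_of_dvd one_pos this
    omega

lemma receiverSignal_eq {N K : ℕ} (hK : 0 < K) (c : Gains K) (P : ℝ) (x n z : Fin (N * K) → ℂ) :
    receiverSignal c P x n z = channelMatrix N c P *ᵥ x + (relayMatrix N c P *ᵥ n + z) := by
  ext p
  rw [receiverSignal, Finset.sum_eq_single (slotRelay hK p), relaySignal_eq hK c P x n p p.2]
  · simp only [Pi.add_apply, Matrix.mulVec, dotProduct, channelMatrix_apply hK,
      relayMatrix_apply hK]
    rw [← add_assoc, ← Finset.sum_add_distrib, Finset.mul_sum, Finset.mul_sum]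
    congr 1
    refine Finset.sum_congr rfl fun q _ => ?_
    rw [outputGain]
    ring
  · intro k _ hk
    rw [relaySignal_eq_zero_of_ne c P x n fun h => hk (Fin.ext h.symm), mul_zero]
  · simp

lemma channelMatrix_lower {N K : ℕ} (hK : 0 < K) (c : Gains K) (P : ℝ) {p q : Fin (N * K)}
    (h : p < q) : channelMatrix N c P p q = 0 := by
  rw [channelMatrix_apply hK, relayMatrix_apply hK, pathGain_of_lt _ h, mul_zero, zero_mul]

/-! ### Second moments of linear combinations of Gaussian symbols -/

lemma measurable_complexMk : Measurable fun p : ℝ × ℝ => Complex.mk p.1 p.2 :=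
  Complex.measurableEquivRealProd.symm.measurable

instance (v : ℝ≥0) : IsProbabilityMeasure (complexNormal v) :=
  Measure.isProbabilityMeasure_map measurable_complexMk.aemeasurable

instance (L : ℕ) (v : ℝ≥0) : IsProbabilityMeasure (iidNormal L v) := by
  unfold iidNormal; infer_instance

lemma memLp_complexNormal (v p : ℝ≥0) : MemLp id (p : ℝ≥0∞) (complexNormal v) := by
  rw [complexNormal, memLp_map_measure_iff aestronglyMeasurable_id measurable_complexMk.aemeasurable,
    ← memLp_re_im_iff]
  exact ⟨(memLp_id_gaussianReal p).comp_fst _, (memLp_id_gaussianReal p).comp_snd _⟩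

lemma integral_complexNormal (v : ℝ≥0) : ∫ z, z ∂complexNormal v = 0 := by
  have h : ∀ p : ℝ × ℝ, Complex.mk p.1 p.2 = (p.1 : ℂ) + (p.2 : ℂ) * Complex.I :=
    fun p => Complex.mk_eq_add_mul_I _ _
  have h1 : Integrable (fun x : ℝ => (x : ℂ)) (gaussianReal 0 (v / 2)) :=
    ((memLp_id_gaussianReal 1).integrable (by simp)).ofReal
  have h2 : ∫ x : ℝ, (x : ℂ) ∂gaussianReal 0 (v / 2) = 0 := by
    rw [integral_complex_ofReal, integral_id_gaussianReal, Complex.ofReal_zero]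
  rw [complexNormal, integral_map measurable_complexMk.aemeasurable (by fun_prop)]
  simp only [h]
  rw [integral_add (h1.comp_fst _) ((h1.comp_snd _).mul_const _), integral_mul_const,
    integral_fun_fst (fun x : ℝ => (x : ℂ)), integral_fun_snd (fun x : ℝ => (x : ℂ)), h2]
  simp

lemma integral_mul_star_complexNormal (v : ℝ≥0) :
    ∫ z, z * star z ∂complexNormal v = (v : ℝ) := by
  have h : ∀ p : ℝ × ℝ, Complex.mk p.1 p.2 * star (Complex.mk p.1 p.2)
      = ((p.1 ^ 2 + p.2 ^ 2 : ℝ) : ℂ) := fun p => by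
    rw [← starRingEnd_apply, Complex.mul_conj, Complex.normSq_mk]
    congr 1
    ring
  have h1 : Integrable (fun x : ℝ => x ^ 2) (gaussianReal 0 (v / 2)) :=
    (memLp_id_gaussianReal 2).integrable_sq
  have h2 : ∫ x : ℝ, x ^ 2 ∂gaussianReal 0 (v / 2) = v / 2 := by
    have := variance_of_integral_eq_zero (X := id) (μ := gaussianReal 0 (v / 2)) aemeasurable_id
      integral_id_gaussianReal
    rw [variance_id_gaussianReal] at this
    simpa using this.symm
  rw [complexNormal, integral_map measurable_complexMk.aemeasurable (by fun_prop)]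
  simp only [h]
  rw [integral_complex_ofReal, integral_add (h1.comp_fst _) (h1.comp_snd _),
    integral_fun_fst (fun x : ℝ => x ^ 2), integral_fun_snd (fun x : ℝ => x ^ 2), h2]
  simp

/-- Square-integrable complex random variables that are pairwise orthogonal, with second moments
`v i`. -/
structure IsWhite {α ι : Type*} [MeasurableSpace α] [DecidableEq ι] (m : Measure α)
    (e : ι → α → ℂ) (v : ι → ℝ) : Prop where
  memLp : ∀ j, MemLp (e j) 2 m
  integral_mul : ∀ j k, ∫ w, e j w * star (e k w) ∂m = if j = k then (v j : ℂ) else 0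

lemma MeasureTheory.MemLp.integrable_mul_star {α : Type*} [MeasurableSpace α] {m : Measure α}
    {f g : α → ℂ} (hf : MemLp f 2 m) (hg : MemLp g 2 m) :
    Integrable (fun w => f w * star (g w)) m :=
  hf.integrable_mul hg.star

section White

variable {α ι : Type*} [MeasurableSpace α] [DecidableEq ι] [Fintype ι] {m : Measure α}
  {e : ι → α → ℂ} {v : ι → ℝ}

lemma IsWhite.memLp_sum (h : IsWhite m e v) (a : ι → ℂ) :
    MemLp (fun w => ∑ j, a j * e j w) 2 m :=
  memLp_finsetSum _ fun j _ => (h.memLp j).const_mul (a j)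

lemma IsWhite.integral_sum (h : IsWhite m e v) (a b : ι → ℂ) :
    ∫ w, (∑ j, a j * e j w) * star (∑ j, b j * e j w) ∂m = ∑ j, a j * star (b j) * v j := by
  have hint : ∀ j k, Integrable (fun w => a j * star (b k) * (e j w * star (e k w))) m :=
    fun j k => ((h.memLp j).integrable_mul_star (h.memLp k)).const_mul _
  have hexp : ∀ w, (∑ j, a j * e j w) * star (∑ j, b j * e j w)
      = ∑ j, ∑ k, a j * star (b k) * (e j w * star (e k w)) := fun w => by
    rw [star_sum, Finset.sum_mul_sum]
    refine Finset.sum_congr rfl fun j _ => Finset.sum_congr rfl fun k _ => ?_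
    rw [star_mul']; ring
  simp only [hexp]
  rw [integral_finsetSum _ fun j _ => integrable_finsetSum _ fun k _ => hint j k]
  refine Finset.sum_congr rfl fun j _ => ?_
  rw [integral_finsetSum _ fun k _ => hint j k]
  simp only [integral_const_mul, h.integral_mul, mul_ite, mul_zero, Finset.sum_ite_eq,
    Finset.mem_univ, if_true]

lemma IsWhite.lintegral_sum (h : IsWhite m e v) (a : ι → ℂ) :
    ∫⁻ w, ‖∑ j, a j * e j w‖ₑ ^ 2 ∂m = ENNReal.ofReal (∑ j, ‖a j‖ ^ 2 * v j) := by
  have hsq : ∀ z : ℂ, z * star z = ((‖z‖ ^ 2 : ℝ) : ℂ) := fun z => by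
    simpa using Complex.mul_conj' z
  have h1 : ∫ w, ‖∑ j, a j * e j w‖ ^ 2 ∂m = ∑ j, ‖a j‖ ^ 2 * v j := by
    have := h.integral_sum a a
    simp only [hsq] at this
    rw [integral_complex_ofReal] at this
    exact_mod_cast this
  have hint : Integrable (fun w => ‖∑ j, a j * e j w‖ ^ 2) m :=
    (memLp_two_iff_integrable_sq_norm (h.memLp_sum a).1).1 (h.memLp_sum a)
  rw [← h1, ofReal_integral_eq_lintegral_ofReal hint
    (.of_forall fun w => by positivity)]
  refine lintegral_congr fun w => ?_
  rw [ENNReal.ofReal_pow (norm_nonneg _), ofReal_norm]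

end White

lemma integral_iidNormal_eval {L : ℕ} (v : ℝ≥0) (j : Fin L) {f : ℂ → ℂ} (hf : Continuous f) :
    ∫ w : Fin L → ℂ, f (w j) ∂iidNormal L v = ∫ z, f z ∂complexNormal v :=
  integral_comp_eval (μ := fun _ : Fin L => complexNormal v) hf.aestronglyMeasurable

lemma isWhite_iidNormal (L : ℕ) (v : ℝ≥0) :
    IsWhite (iidNormal L v) (fun j w => w j) (fun _ : Fin L => (v : ℝ)) where
  memLp j := (memLp_complexNormal v 2).comp_measurePreserving (measurePreserving_eval _ j)
  integral_mul j k := by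
    by_cases hjk : j = k
    · subst hjk
      rw [if_pos rfl, integral_iidNormal_eval v j (f := fun z => z * star z) (by fun_prop),
        integral_mul_star_complexNormal]
    · have hi : iIndepFun (fun (j : Fin L) (w : Fin L → ℂ) => w j) (iidNormal L v) :=
        iIndepFun_pi (X := fun _ => id) fun _ => aemeasurable_id
      have h2 : IndepFun (fun w : Fin L → ℂ => w j) (fun w => star (w k)) (iidNormal L v) :=
        (hi.indepFun hjk).comp (φ := id) (ψ := star) measurable_id (by fun_prop)
      rw [if_neg hjk, h2.integral_fun_mul_eq_mul_integral
        (continuous_apply j).aestronglyMeasurable (continuous_apply k).star.aestronglyMeasurable,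
        integral_iidNormal_eval v j continuous_id', integral_complexNormal, zero_mul]

lemma isWhite_prod_iidNormal (L : ℕ) (v v' : ℝ≥0) :
    IsWhite ((iidNormal L v).prod (iidNormal L v'))
      (fun (j : Fin L ⊕ Fin L) (w : (Fin L → ℂ) × (Fin L → ℂ)) => Sum.elim w.1 w.2 j)
      (Sum.elim (fun _ => (v : ℝ)) (fun _ => (v' : ℝ))) where
  memLp j := by
    rcases j with j | j
    · exact ((isWhite_iidNormal L v).memLp j).comp_fst _
    · exact ((isWhite_iidNormal L v').memLp j).comp_snd _
  integral_mul j k := by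
    have hz : ∀ u : ℝ≥0, ∀ j : Fin L, ∫ w : Fin L → ℂ, w j ∂iidNormal L u = 0 := fun u j => by
      rw [integral_iidNormal_eval u j continuous_id', integral_complexNormal]
    rcases j with j | j <;> rcases k with k | k
    · have := (isWhite_iidNormal L v).integral_mul j k
      simp only [Sum.elim_inl, Sum.inl.injEq]
      rw [integral_fun_fst (fun w : Fin L → ℂ => w j * star (w k)), this]
      simp
    · simp only [Sum.elim_inl, Sum.elim_inr, reduceCtorEq, if_false]
      rw [integral_prod_mul (fun w : Fin L → ℂ => w j) (fun w : Fin L → ℂ => star (w k)), hz, zero_mul]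
    · simp only [Sum.elim_inl, Sum.elim_inr, reduceCtorEq, if_false]
      have h1 := integral_prod_mul (μ := iidNormal L v) (ν := iidNormal L v')
        (fun w : Fin L → ℂ => star (w k)) (fun w : Fin L → ℂ => w j)
      rw [hz, mul_zero] at h1
      rw [← h1]
      exact integral_congr_ae (.of_forall fun w => mul_comm _ _)
    · have := (isWhite_iidNormal L v').integral_mul j k
      simp only [Sum.elim_inr, Sum.inr.injEq]
      rw [integral_fun_snd (fun w : Fin L → ℂ => w j * star (w k)), this]
      simp

/-! ### The noise covariance and the power of the relays -/

lemma noise_eq_sum {L : ℕ} (M : Matrix (Fin L) (Fin L) ℂ) (w : (Fin L → ℂ) × (Fin L → ℂ))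
    (p : Fin L) : (M *ᵥ w.1 + w.2) p
      = ∑ j : Fin L ⊕ Fin L, Sum.elim (M p) (Pi.single p 1) j * Sum.elim w.1 w.2 j := by
  simp [Matrix.mulVec, dotProduct, Pi.single_apply]

lemma integrable_noise {L : ℕ} (M : Matrix (Fin L) (Fin L) ℂ) (p q : Fin L) :
    Integrable (fun w : (Fin L → ℂ) × (Fin L → ℂ) =>
      (M *ᵥ w.1 + w.2) p * star ((M *ᵥ w.1 + w.2) q)) ((iidNormal L 1).prod (iidNormal L 1)) := by
  simp only [noise_eq_sum]
  exact ((isWhite_prod_iidNormal L 1 1).memLp_sum _).integrable_mul_star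
    ((isWhite_prod_iidNormal L 1 1).memLp_sum _)

lemma integral_noise {L : ℕ} (M : Matrix (Fin L) (Fin L) ℂ) (p q : Fin L) :
    ∫ w, (M *ᵥ w.1 + w.2) p * star ((M *ᵥ w.1 + w.2) q)
      ∂((iidNormal L 1).prod (iidNormal L 1)) = (1 + M * Mᴴ) p q := by
  simp only [noise_eq_sum]
  rw [(isWhite_prod_iidNormal L 1 1).integral_sum]
  simp only [Fintype.sum_sum_type, Sum.elim_inl, Sum.elim_inr, Matrix.add_apply, Matrix.mul_apply,
    Matrix.conjTranspose_apply, Pi.single_apply, Matrix.one_apply]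
  simp [add_comm, eq_comm]

lemma amplification_nonneg {K : ℕ} (c : Gains K) {P : ℝ} (hP : 0 < P) (k : Fin K) :
    0 ≤ amplification c P k := le_min zero_le_one (by positivity)

lemma amplification_sq_mul_le {K : ℕ} (c : Gains K) {P : ℝ} (hP : 0 < P) (k : Fin K) :
    amplification c P k ^ 2 * (P * (‖c.h k‖ ^ 2 + ‖c.i (prevRelay k)‖ ^ 2) + 1) ≤ P := by
  have h0 := amplification_nonneg c hP k
  have h1 : amplification c P k ≤ 1 := min_le_left _ _
  have h3 : 0 < P * (‖c.h k‖ ^ 2 + ‖c.i (prevRelay k)‖ ^ 2) + 1 := by positivity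
  have h2 : amplification c P k * (P * (‖c.h k‖ ^ 2 + ‖c.i (prevRelay k)‖ ^ 2) + 1) ≤ P :=
    (le_div_iff₀ h3).1 (min_le_right _ _)
  nlinarith [mul_nonneg h0 h3.le]

/-- The signal of a relay is a linear combination of earlier symbols and noises, of power at most
`P`: the cap on the amplification turns the bound for the preceding relay into that for the next. -/
lemma exists_relaySignal_coeff {K L : ℕ} (c : Gains K) {P : ℝ} (hP : 0 < P) (s : ℕ) (k : Fin K) :
    ∃ a b : Fin L → ℂ, (∀ x n, relaySignal c P x n s k = ∑ j, a j * x j + ∑ j, b j * n j) ∧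
      (∀ j : Fin L, s ≤ j → a j = 0 ∧ b j = 0) ∧
      ∑ j, ‖a j‖ ^ 2 * P + ∑ j, ‖b j‖ ^ 2 ≤ P := by
  induction s generalizing k with
  | zero => exact ⟨0, 0, by simp [relaySignal], by simp, by simpa using hP.le⟩
  | succ s ih =>
    by_cases hs : s < L ∧ s % K = k.val
    · obtain ⟨a, b, h1, h2, h3⟩ := ih (prevRelay k)
      set α : ℂ := (amplification c P k : ℂ)
      let p : Fin L := ⟨s, hs.1⟩
      refine ⟨fun j => α * (c.h k * (if j = p then 1 else 0) + c.i (prevRelay k) * a j),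
        fun j => α * ((if j = p then 1 else 0) + c.i (prevRelay k) * b j), ?_, ?_, ?_⟩
      · intro x n
        rw [relaySignal, dif_pos hs, h1]
        simp only [mul_add, add_mul, Finset.sum_add_distrib, mul_assoc, ← Finset.mul_sum,
          ite_mul, one_mul, zero_mul, Finset.sum_ite_eq', Finset.mem_univ, if_true]
        ring
      · intro j hj
        have hjp : j ≠ p := by rintro rfl; simp [p] at hj
        simp [hjp, h2 j (by omega)]
      · have e1 : ∀ j, ‖α * (c.h k * (if j = p then 1 else 0) + c.i (prevRelay k) * a j)‖ ^ 2
            = ‖α‖ ^ 2 * ((if j = p then ‖c.h k‖ ^ 2 else 0)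
              + ‖c.i (prevRelay k)‖ ^ 2 * ‖a j‖ ^ 2) := by
          intro j
          by_cases hj : j = p
          · simp [hj, (h2 p le_rfl).1, mul_pow]
          · simp [hj, mul_pow]
        have e2 : ∀ j, ‖α * ((if j = p then 1 else 0) + c.i (prevRelay k) * b j)‖ ^ 2
            = ‖α‖ ^ 2 * ((if j = p then 1 else 0) + ‖c.i (prevRelay k)‖ ^ 2 * ‖b j‖ ^ 2) := by
          intro j
          by_cases hj : j = p
          · simp [hj, (h2 p le_rfl).2]
          · simp [hj, mul_pow]
        simp only [e1, e2, ← Finset.sum_mul, ← Finset.mul_sum, Finset.sum_add_distrib,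
          Finset.sum_ite_eq', Finset.mem_univ, if_true] at h3 ⊢
        have e3 : ‖α‖ ^ 2 = amplification c P k ^ 2 := by simp [α]
        rw [e3]
        refine le_trans ?_ (amplification_sq_mul_le c hP k)
        have h4 := mul_le_mul_of_nonneg_left h3 (sq_nonneg ‖c.i (prevRelay k)‖)
        have h5 := mul_le_mul_of_nonneg_left h4 (sq_nonneg (amplification c P k))
        linarith
    · exact ⟨0, 0, by simp [relaySignal, hs], by simp, by simpa using hP.le⟩

lemma lintegral_relaySignal_le {K L : ℕ} (c : Gains K) {P : ℝ} (hP : 0 < P) (s : ℕ) (k : Fin K) :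
    ∫⁻ w, ‖relaySignal c P w.1 w.2 s k‖ₑ ^ 2
      ∂((iidNormal L P.toNNReal).prod (iidNormal L 1)) ≤ ENNReal.ofReal P := by
  obtain ⟨a, b, h1, -, h3⟩ := exists_relaySignal_coeff (L := L) c hP s k
  have h := (isWhite_prod_iidNormal L P.toNNReal 1).lintegral_sum (Sum.elim a b)
  simp only [Fintype.sum_sum_type, Sum.elim_inl, Sum.elim_inr, NNReal.coe_one, mul_one,
    Real.coe_toNNReal P hP.le] at h
  simp only [h1, h]
  exact ENNReal.ofReal_le_ofReal h3

/-! ### Power gains of Rayleigh fading links -/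

/-- The properties of the law of a power gain that determine the large deviations of its exponent: near
`0` it is comparable to Lebesgue measure, and it decays faster than every power at infinity. -/
structure IsFadingLaw (ν : Measure ℝ) : Prop where
  small : ∃ C : ℝ, 0 < C ∧ ∀ t, 0 ≤ t → ν (Set.Iic t) ≤ ENNReal.ofReal (C * t)
  band : ∃ c : ℝ, 0 < c ∧ ∀ t, 0 < t → t ≤ 1 → ENNReal.ofReal (c * t) ≤ ν (Set.Icc (t / 2) t)
  tail : ∀ m : ℕ, ∃ C : ℝ, 0 < C ∧ ∀ t, 0 < t → ν (Set.Ioi t) ≤ ENNReal.ofReal (C / t ^ m)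

lemma complexNormal_prod_subset {v : ℝ≥0} {S : Set ℂ} {A B : Set ℝ} (hS : MeasurableSet S)
    (h : ∀ z : ℂ, z ∈ S → z.re ∈ A ∧ z.im ∈ B) :
    complexNormal v S ≤ gaussianReal 0 (v / 2) A * gaussianReal 0 (v / 2) B := by
  rw [complexNormal, Measure.map_apply measurable_complexMk hS, ← Measure.prod_prod]
  exact measure_mono fun p hp => h _ hp

lemma le_complexNormal_of_prod_subset {v : ℝ≥0} {S : Set ℂ} {A B : Set ℝ} (hS : MeasurableSet S)
    (h : ∀ z : ℂ, z.re ∈ A → z.im ∈ B → z ∈ S) :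
    gaussianReal 0 (v / 2) A * gaussianReal 0 (v / 2) B ≤ complexNormal v S := by
  rw [complexNormal, Measure.map_apply measurable_complexMk hS, ← Measure.prod_prod]
  exact measure_mono fun p hp => h ⟨p.1, p.2⟩ hp.1 hp.2

lemma gaussianReal_Icc_le {v : ℝ≥0} (hv : v ≠ 0) {a b : ℝ} :
    gaussianReal 0 v (Set.Icc a b) ≤ ENNReal.ofReal ((√(2 * Real.pi * v))⁻¹ * (b - a)) := by
  rw [gaussianReal_apply _ hv]
  calc ∫⁻ x in Set.Icc a b, gaussianPDF 0 v x
      ≤ ∫⁻ _ in Set.Icc a b, ENNReal.ofReal (√(2 * Real.pi * v))⁻¹ := by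
        refine lintegral_mono fun x => ENNReal.ofReal_le_ofReal ?_
        rw [gaussianPDFReal]
        refine mul_le_of_le_one_right (by positivity) (Real.exp_le_one_iff.2 ?_)
        exact div_nonpos_of_nonpos_of_nonneg (neg_nonpos.2 (sq_nonneg _)) (by positivity)
    _ = _ := by
        rw [setLIntegral_const, Real.volume_Icc, ← ENNReal.ofReal_mul (by positivity)]

lemma le_gaussianReal_Icc {v : ℝ≥0} (hv : v ≠ 0) {a b : ℝ} (ha : 0 ≤ a) (hb : b ≤ 1) :
    ENNReal.ofReal (gaussianPDFReal 0 v 1 * (b - a)) ≤ gaussianReal 0 v (Set.Icc a b) := by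
  rw [gaussianReal_apply _ hv]
  calc _ = ∫⁻ _ in Set.Icc a b, ENNReal.ofReal (gaussianPDFReal 0 v 1) := by
        rw [setLIntegral_const, Real.volume_Icc, ← ENNReal.ofReal_mul (gaussianPDFReal_nonneg _ _ _)]
    _ ≤ ∫⁻ x in Set.Icc a b, gaussianPDF 0 v x := by
        refine setLIntegral_mono (measurable_gaussianPDF _ _) fun x hx => ENNReal.ofReal_le_ofReal ?_
        rw [gaussianPDFReal, gaussianPDFReal]
        have hx2 : (x - 0) ^ 2 ≤ (1 - 0 : ℝ) ^ 2 := by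
          simp only [sub_zero]
          exact pow_le_pow_left₀ (ha.trans hx.1) (hx.2.trans hb) 2
        gcongr

lemma isFadingLaw_complexNormal {v : ℝ≥0} (hv : 0 < v) :
    IsFadingLaw ((complexNormal v).map fun z => ‖z‖ ^ 2) := by
  have hv2 : v / 2 ≠ 0 := by positivity
  have hmeas : Measurable fun z : ℂ => ‖z‖ ^ 2 := by fun_prop
  have hsq : ∀ z : ℂ, ‖z‖ ^ 2 = z.re ^ 2 + z.im ^ 2 := fun z => by
    rw [Complex.sq_norm, Complex.normSq_apply]; ring
  refine ⟨?_, ?_, ?_⟩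
  · set c := (√(2 * Real.pi * (v / 2 : ℝ≥0)))⁻¹ with hc
    have hc0 : 0 < c := by
      have : (0 : ℝ) < (v / 2 : ℝ≥0) := by exact_mod_cast pos_iff_ne_zero.2 hv2
      positivity
    refine ⟨4 * c ^ 2, by positivity, fun t ht => ?_⟩
    rw [Measure.map_apply hmeas measurableSet_Iic]
    have h1 := gaussianReal_Icc_le hv2 (a := -√t) (b := √t)
    refine (complexNormal_prod_subset (A := Set.Icc (-√t) √t) (B := Set.Icc (-√t) √t)
      (hmeas measurableSet_Iic) fun z hz => ?_).trans ((mul_le_mul' h1 h1).trans (le_of_eq ?_))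
    · have hz' : z.re ^ 2 + z.im ^ 2 ≤ t := by rw [← hsq]; exact hz
      exact ⟨abs_le.1 (Real.abs_le_sqrt (by nlinarith)), abs_le.1 (Real.abs_le_sqrt (by nlinarith))⟩
    · rw [← ENNReal.ofReal_mul (by have := Real.sqrt_nonneg t; rw [← hc]; nlinarith)]
      congr 1
      rw [← hc]
      nlinarith [Real.sq_sqrt ht]
  · set c := gaussianPDFReal 0 (v / 2) 1
    have hc0 : 0 < c := gaussianPDFReal_pos _ _ _ hv2
    refine ⟨c ^ 2 / 25, by positivity, fun t ht ht1 => ?_⟩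
    rw [Measure.map_apply hmeas measurableSet_Icc]
    have hs := Real.sqrt_nonneg t
    have hs1 : √t ≤ 1 := Real.sqrt_le_one.2 ht1
    have hst := Real.sq_sqrt ht.le
    -- both coordinates in `[√t / 2, 7 √t / 10]` give a squared norm between `t / 2` and `t`
    have h1 := le_gaussianReal_Icc hv2 (a := √t / 2) (b := 7 / 10 * √t) (by positivity) (by linarith)
    refine le_trans (le_of_eq ?_) ((mul_le_mul' h1 h1).trans
      (le_complexNormal_of_prod_subset (hmeas measurableSet_Icc) fun z hr hi => ?_))
    · have : 0 ≤ 7 / 10 * √t - √t / 2 := by linarith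
      rw [← ENNReal.ofReal_mul (by positivity)]
      congr 1
      nlinarith
    · simp only [Set.mem_preimage, Set.mem_Icc, hsq] at hr hi ⊢
      constructor <;> nlinarith
  · intro m
    have hint : Integrable (fun z : ℂ => ‖z‖ ^ (2 * m)) (complexNormal v) := by
      have := (memLp_complexNormal v ((2 * m : ℕ) : ℝ≥0)).integrable_norm_pow'
      simpa using this
    refine ⟨∫ z, ‖z‖ ^ (2 * m) ∂complexNormal v + 1,
      by have : 0 ≤ ∫ z, ‖z‖ ^ (2 * m) ∂complexNormal v := integral_nonneg fun z => by positivity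
         linarith, fun t ht => ?_⟩
    rw [Measure.map_apply hmeas measurableSet_Ioi]
    have hmk := mul_meas_ge_le_integral_of_nonneg
      (.of_forall fun z : ℂ => by positivity) hint (t ^ m)
    rw [← ofReal_measureReal]
    refine ENNReal.ofReal_le_ofReal ?_
    rw [le_div_iff₀ (by positivity), mul_comm]
    refine le_trans (mul_le_mul_of_nonneg_left (measureReal_mono fun z hz => ?_) (by positivity))
      (hmk.trans (by linarith))
    simp only [Set.mem_preimage, Set.mem_Ioi, Set.mem_ofPred_eq] at hz ⊢
    rw [pow_mul]
    exact pow_le_pow_left₀ ht.le hz.le m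

/-- The negative moments of a fading law, cut off at `1`, are finite up to (but excluding) order
one. -/
lemma IsFadingLaw.lintegral_max_rpow_lt_top {ν : Measure ℝ} [IsProbabilityMeasure ν]
    (h : IsFadingLaw ν) {s : ℝ} (hs0 : 0 < s) (hs : s < 1) :
    ∫⁻ z, ENNReal.ofReal (max 1 (z ^ (-s))) ∂ν < ∞ := by
  obtain ⟨C, hC, hsmall⟩ := h.small
  have hf : AEMeasurable (fun z : ℝ => max 1 (z ^ (-s))) ν := by fun_prop
  rw [lintegral_eq_lintegral_meas_lt ν (.of_forall fun z => zero_le_one.trans (le_max_left _ _)) hf]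
  have hsplit : Set.Ioi (0 : ℝ) ⊆ Set.Ioc 0 1 ∪ Set.Ioi 1 := fun x hx => by
    rcases le_or_gt x 1 with h | h
    · exact Or.inl ⟨hx, h⟩
    · exact Or.inr h
  refine (lintegral_mono_set hsplit).trans_lt ((lintegral_union_le _ _ _).trans_lt ?_)
  refine ENNReal.add_lt_top.2 ⟨?_, ?_⟩
  · refine (lintegral_mono (g := fun _ => 1) fun _ => prob_le_one).trans_lt ?_
    simp
  · have hint : IntegrableOn (fun t : ℝ => C * t ^ (-s⁻¹)) (Set.Ioi 1) :=
      (integrableOn_Ioi_rpow_of_lt (by rw [neg_lt_neg_iff]; exact one_lt_inv₀ hs0 |>.2 hs)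
        one_pos).const_mul C
    refine lt_of_le_of_lt ?_ hint.lintegral_lt_top
    refine setLIntegral_mono' measurableSet_Ioi fun t (ht : 1 < t) => ?_
    have ht0 : 0 < t := zero_lt_one.trans ht
    refine le_trans ?_ (hsmall (t ^ (-s⁻¹)) (by positivity))
    refine measure_mono fun z (hz : t < max 1 (z ^ (-s))) => ?_
    show z ≤ t ^ (-s⁻¹)
    rcases le_or_gt z 0 with hz0 | hz0
    · exact hz0.trans (by positivity)
    have h1 : t < z ^ (-s) := (lt_max_iff.1 hz).resolve_left (not_lt.2 ht.le)
    have h2 := Real.rpow_le_rpow_of_nonpos ht0 h1.le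
      (neg_nonpos.2 (inv_nonneg.2 hs0.le) : -s⁻¹ ≤ 0)
    rwa [← Real.rpow_mul hz0.le, neg_mul_neg, mul_inv_cancel₀ hs0.ne', Real.rpow_one] at h2

/-! ### Large deviations on the logarithmic scale -/

lemma log_ofReal_rpow_div {P : ℝ} (hP : 1 < P) (a : ℝ) :
    -(ENNReal.log (ENNReal.ofReal (P ^ (-a)))) / ((Real.log P : ℝ) : EReal) = (a : EReal) := by
  have hl := Real.log_pos hP
  rw [ENNReal.log_ofReal_of_pos (by positivity), Real.log_rpow (by linarith), ← EReal.coe_neg,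
    ← EReal.coe_div]
  congr 1
  field_simp

lemma hasDiversityGain_of_bounds {p : ℝ → ℝ≥0∞} {d : ℝ}
    (h1 : ∀ ε > 0, ∀ᶠ P in atTop, p P ≤ ENNReal.ofReal (P ^ (-(d - ε))))
    (h2 : ∀ ε > 0, ∀ᶠ P in atTop, ENNReal.ofReal (P ^ (-(d + ε))) ≤ p P) :
    HasDiversityGain p d := by
  have hmono : ∀ {P : ℝ} {a b : ℝ≥0∞}, 1 < P → a ≤ b →
      -(ENNReal.log b) / ((Real.log P : ℝ) : EReal) ≤ -(ENNReal.log a) / ((Real.log P : ℝ) : EReal) :=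
    fun hP hab => EReal.div_le_div_right_of_nonneg
      (by exact_mod_cast (Real.log_pos hP).le) (EReal.neg_le_neg_iff.2 (ENNReal.log_le_log hab))
  refine tendsto_order.2 ⟨fun a ha => ?_, fun a ha => ?_⟩
  · obtain ⟨q, hq1, hq2⟩ := EReal.lt_iff_exists_real_btwn.1 ha
    have hq2' : q < d := by exact_mod_cast hq2
    filter_upwards [h1 (d - q) (by linarith), eventually_gt_atTop 1] with P hP hP1
    have := hmono hP1 hP
    rw [log_ofReal_rpow_div hP1] at this
    refine hq1.trans_le (le_trans ?_ this)
    exact_mod_cast (by linarith : q ≤ d - (d - q))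
  · obtain ⟨q, hq1, hq2⟩ := EReal.lt_iff_exists_real_btwn.1 ha
    have hq1' : d < q := by exact_mod_cast hq1
    filter_upwards [h2 (q - d) (by linarith), eventually_gt_atTop 1] with P hP hP1
    have := hmono hP1 hP
    rw [log_ofReal_rpow_div hP1] at this
    refine (this.trans ?_).trans_lt hq2
    exact_mod_cast (by linarith : d + (q - d) ≤ q)

lemma eventually_const_mul_rpow_le (C : ℝ) {a b : ℝ} (hab : b < a) :
    ∀ᶠ P : ℝ in atTop, C * P ^ (-a) ≤ P ^ (-b) := by
  filter_upwards [(tendsto_rpow_atTop (sub_pos.2 hab)).eventually_ge_atTop C,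
    eventually_gt_atTop 0] with P hP hP0
  calc C * P ^ (-a) ≤ P ^ (a - b) * P ^ (-a) := by gcongr
    _ = P ^ (-b) := by rw [← Real.rpow_add hP0]; congr 1; ring

/-- The exponents, to the base `1 / P`, of the gains `z`. -/
noncomputable def gainExponent {ι : Type*} (P : ℝ) (z : ι → ℝ) : ι → ℝ :=
  fun j => -Real.log (z j) / Real.log P

/-- A lower bound on the sum of the exponents that holds where `φ ≤ c` on the nonnegative orthant
persists, up to `ε`, under small violations of both constraints. -/
lemma exists_relaxed_bound {ι : Type*} [Fintype ι] {φ : (ι → ℝ) → ℝ} (hφ : Continuous φ) {c J : ℝ}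
    (hJ : ∀ x : ι → ℝ, (∀ j, 0 ≤ x j) → φ x ≤ c → J ≤ ∑ j, x j) {ε : ℝ} (hε : 0 < ε) :
    ∃ δ > 0, ∀ x : ι → ℝ, (∀ j, -δ ≤ x j) → φ x ≤ c + δ → J - ε ≤ ∑ j, max 0 (x j) := by
  by_contra! hcon
  choose! x hx1 hx2 hx3 using hcon
  have hpos : ∀ n : ℕ, (0 : ℝ) < 1 / ((n : ℝ) + 1) := fun n => by positivity
  have hmem : ∀ n : ℕ, x (1 / ((n : ℝ) + 1)) ∈ Set.Icc (fun _ : ι => (-1 : ℝ)) (fun _ => J) := by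
    intro n
    have h1 : 1 / ((n : ℝ) + 1) ≤ 1 := by
      rw [div_le_one (by positivity)]; linarith [n.cast_nonneg (α := ℝ)]
    refine ⟨fun j => by have := hx1 _ (hpos n) j; linarith, fun j => ?_⟩
    have h2 := Finset.single_le_sum (f := fun j => max 0 (x (1 / ((n : ℝ) + 1)) j))
      (fun j _ => le_max_left 0 _) (Finset.mem_univ j)
    have h3 := hx3 _ (hpos n)
    have h4 := le_max_right 0 (x (1 / ((n : ℝ) + 1)) j)
    linarith
  obtain ⟨y, -, ψ, hψ, hlim⟩ := isCompact_Icc.tendsto_subseq hmem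
  have hδ : Tendsto (fun n => 1 / ((ψ n : ℝ) + 1)) atTop (𝓝 0) :=
    tendsto_one_div_add_atTop_nhds_zero_nat.comp hψ.tendsto_atTop
  have hlimj : ∀ j, Tendsto (fun n => x (1 / ((ψ n : ℝ) + 1)) j) atTop (𝓝 (y j)) :=
    fun j => (tendsto_pi_nhds.1 hlim) j
  have hy0 : ∀ j, 0 ≤ y j := fun j => by
    have h0 : Tendsto (fun n => -(1 / ((ψ n : ℝ) + 1))) atTop (𝓝 0) := by simpa using hδ.neg
    exact le_of_tendsto_of_tendsto' h0 (hlimj j) fun n => hx1 _ (hpos _) j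
  have hyc : φ y ≤ c := by
    have h0 : Tendsto (fun n => c + 1 / ((ψ n : ℝ) + 1)) atTop (𝓝 c) := by
      simpa using tendsto_const_nhds.add hδ
    exact le_of_tendsto_of_tendsto' ((hφ.tendsto y).comp hlim) h0 fun n => hx2 _ (hpos _)
  have hys : ∑ j, max 0 (y j) ≤ J - ε :=
    le_of_tendsto' (tendsto_finsetSum _ fun j _ => tendsto_const_nhds.max (hlimj j))
      fun n => (hx3 _ (hpos _)).le
  have h1 := hJ y hy0 hyc
  have h2 : ∑ j, y j ≤ ∑ j, max 0 (y j) := Finset.sum_le_sum fun j _ => le_max_right _ _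
  linarith

section Fading

variable {Ω : Type*} [MeasurableSpace Ω] {μ : Measure Ω} {ι : Type*}
  [Fintype ι] {Z : ι → Ω → ℝ}

lemma measure_nonpos_eq_zero {X : Ω → ℝ} (hX : AEMeasurable X μ) (h : IsFadingLaw (μ.map X)) :
    μ {ω | X ω ≤ 0} = 0 := by
  obtain ⟨C, -, hC⟩ := h.small
  have := hC 0 le_rfl
  rw [Measure.map_apply_of_aemeasurable hX measurableSet_Iic, mul_zero, ENNReal.ofReal_zero] at this
  exact le_antisymm this bot_le

lemma ae_forall_pos (hZ : ∀ j, AEMeasurable (Z j) μ) (hlaw : ∀ j, IsFadingLaw (μ.map (Z j))) :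
    ∀ᵐ ω ∂μ, ∀ j, 0 < Z j ω := by
  refine ae_all_iff.2 fun j => ?_
  rw [ae_iff]
  simpa using measure_nonpos_eq_zero (hZ j) (hlaw j)

/-- The exponents are close to a given nonnegative point with a probability of the expected order. -/
lemma exists_le_measure_band (hZ : ∀ j, AEMeasurable (Z j) μ)
    (hlaw : ∀ j, IsFadingLaw (μ.map (Z j))) (hind : iIndepFun Z μ) :
    ∃ c : ℝ, 0 < c ∧ ∀ x : ι → ℝ, (∀ j, 0 ≤ x j) → ∀ P : ℝ, 1 < P →
      ENNReal.ofReal (c * P ^ (-∑ j, x j))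
        ≤ μ {ω | ∀ j, Z j ω ∈ Set.Icc (P ^ (-x j) / 2) (P ^ (-x j))} := by
  choose c hc0 hc using fun j => (hlaw j).band
  refine ⟨∏ j, c j, Finset.prod_pos fun j _ => hc0 j, fun x hx P hP => ?_⟩
  have hP0 : 0 < P := by linarith
  have h1 := hind.measure_inter_preimage_eq_mul Finset.univ
    (sets := fun j => Set.Icc (P ^ (-x j) / 2) (P ^ (-x j))) fun j _ => measurableSet_Icc
  have h2 : {ω | ∀ j, Z j ω ∈ Set.Icc (P ^ (-x j) / 2) (P ^ (-x j))}
      = ⋂ j ∈ Finset.univ, Z j ⁻¹' Set.Icc (P ^ (-x j) / 2) (P ^ (-x j)) := by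
    ext ω; simp
  rw [h2, h1, ← Finset.sum_neg_distrib, Real.rpow_sum_of_pos hP0, ← Finset.prod_mul_distrib,
    ENNReal.ofReal_prod_of_nonneg fun j _ => mul_nonneg (hc0 j).le (by positivity)]
  refine Finset.prod_le_prod' fun j _ => ?_
  rw [← Measure.map_apply_of_aemeasurable (hZ j) measurableSet_Icc]
  exact hc j _ (by positivity) (Real.rpow_le_one_of_one_le_of_nonpos hP.le (by linarith [hx j]))

/-- Markov's inequality for the product of the negative moments of order `s < 1`. -/
lemma exists_measure_sum_le [IsProbabilityMeasure μ] (hZ : ∀ j, AEMeasurable (Z j) μ)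
    (hlaw : ∀ j, IsFadingLaw (μ.map (Z j))) (hind : iIndepFun Z μ) {s : ℝ} (hs0 : 0 < s)
    (hs : s < 1) :
    ∃ C : ℝ, 0 ≤ C ∧ ∀ J P : ℝ, 1 < P →
      μ {ω | (∀ j, 0 < Z j ω) ∧ J ≤ ∑ j, max 0 (gainExponent P (fun j => Z j ω) j)}
        ≤ ENNReal.ofReal (C * P ^ (-(s * J))) := by
  set f : ℝ → ℝ≥0∞ := fun z => ENNReal.ofReal (max 1 (z ^ (-s)))
  have hf : Measurable f := by fun_prop
  let Z' : ι → Ω → ℝ := fun j => (hZ j).mk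
  have hZ' : ∀ j, Measurable (Z' j) := fun j => (hZ j).measurable_mk
  have hae : ∀ j, Z j =ᵐ[μ] Z' j := fun j => (hZ j).ae_eq_mk
  have hind' : iIndepFun Z' μ := hind.congr hae
  have hlt : ∀ j, ∫⁻ ω, f (Z' j ω) ∂μ < ∞ := fun j => by
    have : IsProbabilityMeasure (μ.map (Z j)) := Measure.isProbabilityMeasure_map (hZ j)
    have h1 := (hlaw j).lintegral_max_rpow_lt_top hs0 hs
    rw [Measure.map_congr (hae j), lintegral_map hf (hZ' j)] at h1
    exact h1
  have hprod : ∫⁻ ω, ∏ j, f (Z' j ω) ∂μ = ∏ j, ∫⁻ ω, f (Z' j ω) ∂μ :=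
    lintegral_prod_eq_prod_lintegral_of_indepFun Finset.univ (fun j ω => f (Z' j ω))
      (hind'.comp (fun _ => f) fun _ => hf) fun j => hf.comp (hZ' j)
  set E := ∏ j, ∫⁻ ω, f (Z' j ω) ∂μ with hE
  have hE_top : E ≠ ∞ := ENNReal.prod_ne_top fun j _ => (hlt j).ne
  refine ⟨E.toReal, ENNReal.toReal_nonneg, fun J P hP => ?_⟩
  have hP0 : 0 < P := by linarith
  have hl : 0 < Real.log P := Real.log_pos hP
  have hsub : ∀ᵐ ω ∂μ, ω ∈ {ω | (∀ j, 0 < Z j ω) ∧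
      J ≤ ∑ j, max 0 (gainExponent P (fun j => Z j ω) j)} →
      ω ∈ {ω | ENNReal.ofReal (P ^ (s * J)) ≤ ∏ j, f (Z' j ω)} := by
    filter_upwards [ae_all_iff.2 hae] with ω hω hmem
    obtain ⟨hpos, hJ⟩ := hmem
    simp only [f, ← hω]
    rw [← ENNReal.ofReal_prod_of_nonneg fun j _ => zero_le_one.trans (le_max_left _ _)]
    refine ENNReal.ofReal_le_ofReal ?_
    calc P ^ (s * J) ≤ P ^ (∑ j, s * max 0 (gainExponent P (fun j => Z j ω) j)) := by
          rw [← Finset.mul_sum]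
          exact Real.rpow_le_rpow_of_exponent_le hP.le (mul_le_mul_of_nonneg_left hJ hs0.le)
      _ = ∏ j, P ^ (s * max 0 (gainExponent P (fun j => Z j ω) j)) :=
          Real.rpow_sum_of_pos hP0 _ _
      _ ≤ ∏ j, max 1 ((Z j ω) ^ (-s)) := by
          refine Finset.prod_le_prod (fun j _ => by positivity) fun j _ => ?_
          rcases max_choice 0 (gainExponent P (fun j => Z j ω) j) with h | h
          · rw [h, mul_zero, Real.rpow_zero]; exact le_max_left _ _
          · refine le_max_of_le_right (le_of_eq ?_)
            rw [h, Real.rpow_def_of_pos hP0, Real.rpow_def_of_pos (hpos j), gainExponent]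
            congr 1
            field_simp
  calc μ _ ≤ μ {ω | ENNReal.ofReal (P ^ (s * J)) ≤ ∏ j, f (Z' j ω)} := measure_mono_ae hsub
    _ ≤ (∫⁻ ω, ∏ j, f (Z' j ω) ∂μ) / ENNReal.ofReal (P ^ (s * J)) :=
        meas_ge_le_lintegral_div
          (Finset.aemeasurable_fun_prod _ fun j _ => (hf.comp (hZ' j)).aemeasurable)
          (by simpa using Real.rpow_pos_of_pos hP0 _) ENNReal.ofReal_ne_top
    _ = ENNReal.ofReal (E.toReal * P ^ (-(s * J))) := by
        rw [hprod, ENNReal.ofReal_mul ENNReal.toReal_nonneg, ENNReal.ofReal_toReal hE_top,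
          Real.rpow_neg hP0.le, ENNReal.ofReal_inv_of_pos (by positivity), div_eq_mul_inv]

lemma exists_measure_neg_exponent_le (hZ : ∀ j, AEMeasurable (Z j) μ)
    (hlaw : ∀ j, IsFadingLaw (μ.map (Z j))) {δ : ℝ} (hδ : 0 < δ) (q : ℝ) :
    ∃ C : ℝ, 0 ≤ C ∧ ∀ P : ℝ, 1 < P →
      μ {ω | (∀ j, 0 < Z j ω) ∧ ∃ j, gainExponent P (fun j => Z j ω) j < -δ}
        ≤ ENNReal.ofReal (C * P ^ (-q)) := by
  obtain ⟨m, hm⟩ := exists_nat_ge (q / δ)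
  choose C hC0 hC using fun j => (hlaw j).tail m
  refine ⟨∑ j, C j, Finset.sum_nonneg fun j _ => (hC0 j).le, fun P hP => ?_⟩
  have hP0 : 0 < P := by linarith
  have hl : 0 < Real.log P := Real.log_pos hP
  have hsub : {ω | (∀ j, 0 < Z j ω) ∧ ∃ j, gainExponent P (fun j => Z j ω) j < -δ}
      ⊆ ⋃ j, Z j ⁻¹' Set.Ioi (P ^ δ) := by
    rintro ω ⟨hpos, j, hj⟩
    refine Set.mem_iUnion.2 ⟨j, ?_⟩
    rw [gainExponent, div_lt_iff₀ hl] at hj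
    show P ^ δ < Z j ω
    rw [← Real.log_lt_log_iff (by positivity) (hpos j), Real.log_rpow hP0]
    linarith
  refine (measure_mono hsub).trans ((measure_iUnion_fintype_le μ _).trans ?_)
  rw [Finset.sum_mul, ENNReal.ofReal_sum_of_nonneg fun j _ => mul_nonneg (hC0 j).le (by positivity)]
  refine Finset.sum_le_sum fun j _ => ?_
  rw [← Measure.map_apply_of_aemeasurable (hZ j) measurableSet_Ioi]
  refine (hC j _ (by positivity)).trans (ENNReal.ofReal_le_ofReal ?_)
  rw [div_eq_mul_inv, ← Real.rpow_natCast, ← Real.rpow_mul hP0.le, ← Real.rpow_neg hP0.le]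
  refine mul_le_mul_of_nonneg_left (Real.rpow_le_rpow_of_exponent_le hP.le ?_) (hC0 j).le
  rw [div_le_iff₀ hδ] at hm
  linarith

/-- The diversity gain of an outage event whose mutual information `f P` is, on the scale `log P`, a
continuous function `φ` of the exponents of the gains: the least sum of nonnegative exponents for which
`φ` is at most `c`. The condition that `φ` decreases in the direction `e`, as long as it is positive, makes
the infimum the same for `φ x < c`, so that the limit exists. -/
theorem hasDiversityGain_sInf [IsProbabilityMeasure μ] (hZ : ∀ j, AEMeasurable (Z j) μ)
    (hlaw : ∀ j, IsFadingLaw (μ.map (Z j))) (hind : iIndepFun Z μ) {φ : (ι → ℝ) → ℝ}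
    (hφ : Continuous φ) {f : ℝ → Ω → ℝ} {C : ℝ}
    (hf : ∀ P ω, 1 < P → (∀ j, 0 < Z j ω) →
      |f P ω - Real.log P * φ (gainExponent P fun j => Z j ω)| ≤ C)
    {e : ι → ℝ} (he : ∀ j, 0 ≤ e j)
    (hdir : ∀ x : ι → ℝ, (∀ j, 0 ≤ x j) → ∀ δ, 0 ≤ δ → φ (x + δ • e) ≤ max 0 (φ x - δ))
    {c : ℝ} (hc : 0 < c) :
    HasDiversityGain (fun P => μ {ω | f P ω ≤ c * Real.log P})
      (sInf {t | ∃ x : ι → ℝ, (∀ j, 0 ≤ x j) ∧ φ x ≤ c ∧ t = ∑ j, x j} : ℝ) := by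
  set T := {t | ∃ x : ι → ℝ, (∀ j, 0 ≤ x j) ∧ φ x ≤ c ∧ t = ∑ j, x j} with hT
  have hT0 : ∀ t ∈ T, 0 ≤ t := by
    rintro t ⟨x, hx, -, rfl⟩
    exact Finset.sum_nonneg fun j _ => hx j
  have hne : T.Nonempty := by
    have h0 := hdir 0 (fun _ => le_rfl) (max 0 (φ 0)) (le_max_left _ _)
    refine ⟨_, 0 + max 0 (φ 0) • e, fun j => ?_, h0.trans (max_le hc.le ?_), rfl⟩
    · simpa using mul_nonneg (le_max_left 0 (φ 0)) (he j)
    · linarith [le_max_right 0 (φ 0)]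
  have hbdd : BddBelow T := ⟨0, hT0⟩
  set J := sInf T
  have hJ0 : 0 ≤ J := Real.sInf_nonneg hT0
  have hJ : ∀ x : ι → ℝ, (∀ j, 0 ≤ x j) → φ x ≤ c → J ≤ ∑ j, x j :=
    fun x hx hxc => csInf_le hbdd ⟨x, hx, hxc, rfl⟩
  have hlog : ∀ q : ℝ, ∀ᶠ P : ℝ in atTop, q ≤ Real.log P :=
    fun q => Real.tendsto_log_atTop.eventually_ge_atTop q
  refine hasDiversityGain_of_bounds (fun ε hε => ?_) fun ε hε => ?_
  · obtain ⟨δ, hδ, hrel⟩ := exists_relaxed_bound hφ hJ (ε := ε / 4) (by linarith)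
    -- the order `s` is so close to `1` that `s * (J - ε / 4) ≥ J - ε / 2`
    obtain ⟨s, hs0, hs1, hsJ⟩ : ∃ s : ℝ, 0 < s ∧ s < 1 ∧ J - ε / 2 ≤ s * (J - ε / 4) := by
      refine ⟨(J + ε) / (J + ε + ε / 4), by positivity, by rw [div_lt_one (by positivity)]; linarith,
        ?_⟩
      rw [div_mul_eq_mul_div, le_div_iff₀ (by positivity)]
      nlinarith [mul_pos hε hε, mul_nonneg hJ0 hε.le]
    obtain ⟨C₁, hC₁, h1⟩ := exists_measure_sum_le hZ hlaw hind hs0 hs1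
    obtain ⟨C₂, hC₂, h2⟩ := exists_measure_neg_exponent_le hZ hlaw hδ J
    filter_upwards [eventually_gt_atTop 1, hlog (C / δ),
      eventually_const_mul_rpow_le (C₁ + C₂) (show J - ε < J - ε / 2 by linarith)] with P hP hPl hPC
    have hP0 : 0 < P := by linarith
    have hl : 0 < Real.log P := Real.log_pos hP
    have hsub : ∀ᵐ ω ∂μ, ω ∈ {ω | f P ω ≤ c * Real.log P} →
        ω ∈ {ω | (∀ j, 0 < Z j ω) ∧ J - ε / 4 ≤ ∑ j, max 0 (gainExponent P (fun j => Z j ω) j)} ∪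
          {ω | (∀ j, 0 < Z j ω) ∧ ∃ j, gainExponent P (fun j => Z j ω) j < -δ} := by
      filter_upwards [ae_forall_pos hZ hlaw] with ω hpos hmem
      have hmem' : f P ω ≤ c * Real.log P := hmem
      by_cases hneg : ∃ j, gainExponent P (fun j => Z j ω) j < -δ
      · exact Or.inr ⟨hpos, hneg⟩
      · push Not at hneg
        refine Or.inl ⟨hpos, hrel _ hneg ?_⟩
        have h3 := (abs_le.1 (hf P ω hP hpos)).1
        rw [div_le_iff₀ hδ] at hPl
        refine le_of_mul_le_mul_left ?_ hl
        nlinarith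
    calc μ {ω | f P ω ≤ c * Real.log P}
        ≤ ENNReal.ofReal (C₁ * P ^ (-(s * (J - ε / 4)))) + ENNReal.ofReal (C₂ * P ^ (-J)) :=
          (measure_mono_ae hsub).trans ((measure_union_le _ _).trans
            (add_le_add (h1 _ P hP) (h2 P hP)))
      _ = ENNReal.ofReal (C₁ * P ^ (-(s * (J - ε / 4))) + C₂ * P ^ (-J)) :=
          (ENNReal.ofReal_add (by positivity) (by positivity)).symm
      _ ≤ ENNReal.ofReal (P ^ (-(J - ε))) := by
          refine ENNReal.ofReal_le_ofReal (le_trans ?_ hPC)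
          rw [add_mul]
          refine add_le_add (mul_le_mul_of_nonneg_left ?_ hC₁) (mul_le_mul_of_nonneg_left ?_ hC₂)
          · exact Real.rpow_le_rpow_of_exponent_le hP.le (by linarith)
          · exact Real.rpow_le_rpow_of_exponent_le hP.le (by linarith)
  · -- a point in the interior of the outage region whose sum exceeds `J` by less than `ε`
    obtain ⟨x, hx, hxc, hxJ⟩ : ∃ x : ι → ℝ, (∀ j, 0 ≤ x j) ∧ φ x < c ∧ ∑ j, x j < J + ε := by
      obtain ⟨t, ⟨x, hx, hxc, rfl⟩, ht⟩ :=
        exists_lt_of_csInf_lt hne (show sInf T < J + ε / 2 by linarith)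
      have hE : 0 ≤ ∑ j, e j := Finset.sum_nonneg fun j _ => he j
      set δ := ε / (2 * (∑ j, e j + 1)) with hδ
      have hδ0 : 0 < δ := by positivity
      have hδE : δ * ∑ j, e j < ε / 2 := by
        rw [hδ, div_mul_eq_mul_div, div_lt_div_iff₀ (by positivity) two_pos]
        nlinarith
      refine ⟨x + δ • e, fun j => ?_, ?_, ?_⟩
      · have := mul_nonneg hδ0.le (he j)
        simpa using add_nonneg (hx j) this
      · exact (hdir x hx δ hδ0.le).trans_lt (max_lt hc (by linarith))
      · simp only [Pi.add_apply, Pi.smul_apply, smul_eq_mul, Finset.sum_add_distrib,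
          ← Finset.mul_sum]
        linarith
    obtain ⟨c₀, hc₀, hband⟩ := exists_le_measure_band hZ hlaw hind
    obtain ⟨c', hc'1, hc'2⟩ := exists_between hxc
    obtain ⟨ρ, hρ, hball⟩ := Metric.continuous_iff.1 hφ x (c' - φ x) (by linarith)
    filter_upwards [eventually_gt_atTop 1, hlog (C / (c - c')), hlog (2 * Real.log 2 / ρ),
      eventually_const_mul_rpow_le c₀⁻¹ hxJ] with P hP hPl hPρ hPc
    have hP0 : 0 < P := by linarith
    have hl : 0 < Real.log P := Real.log_pos hP
    refine le_trans (ENNReal.ofReal_le_ofReal ?_) ((hband x hx P hP).trans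
      (measure_mono fun ω hω => ?_))
    · rw [inv_mul_le_iff₀ hc₀] at hPc
      exact hPc
    · have hpos : ∀ j, 0 < Z j ω := fun j => lt_of_lt_of_le (by positivity) (hω j).1
      have hclose : dist (gainExponent P fun j => Z j ω) x < ρ := by
        refine (dist_pi_lt_iff hρ).2 fun j => ?_
        have h1 := Real.log_le_log (by positivity) (hω j).1
        have h2 := Real.log_le_log (hpos j) (hω j).2
        rw [Real.log_div (by positivity) two_ne_zero, Real.log_rpow hP0] at h1
        rw [Real.log_rpow hP0] at h2
        have hl2 := Real.log_pos one_lt_two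
        rw [div_le_iff₀ hρ] at hPρ
        rw [Real.dist_eq, gainExponent, show -Real.log (Z j ω) / Real.log P - x j
          = (-Real.log (Z j ω) - Real.log P * x j) / Real.log P by field_simp, abs_div,
          abs_of_pos hl, div_lt_iff₀ hl, abs_lt]
        constructor <;> nlinarith
      have h3 := (abs_lt.1 (by simpa [Real.dist_eq] using hball _ hclose)).2
      have h4 := (abs_le.1 (hf P ω hP hpos)).2
      rw [div_le_iff₀ (by linarith)] at hPl
      show f P ω ≤ c * Real.log P
      nlinarith

end Fading

/-! ### The exponent of the mutual information -/

/-- The exponent of the amplification of relay `k`, to the base `P`, as a function of the exponents `x`, to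
the base `1 / P`, of the power gains `‖h k‖ ^ 2`, `‖g k‖ ^ 2` and `‖i k‖ ^ 2`, in this order. -/
def ampExponent {K : ℕ} (x : Fin K ⊕ (Fin K ⊕ Fin K) → ℝ) (k : Fin K) : ℝ :=
  min 0 (1 - max (max (1 - x (.inl k)) (1 - x (.inr (.inr (prevRelay k))))) 0)

/-- The exponent of `inputVar`. -/
def inputExponent {K : ℕ} (hK : 0 < K) (x : Fin K ⊕ (Fin K ⊕ Fin K) → ℝ) (m : ℕ) : ℝ :=
  max 0 (1 - x (.inl (slotRelay hK m)))

/-- The exponent of the squared norm of `outputGain`. -/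
def outputExponent {K : ℕ} (hK : 0 < K) (x : Fin K ⊕ (Fin K ⊕ Fin K) → ℝ) (m : ℕ) : ℝ :=
  -x (.inr (.inl (slotRelay hK m))) +
    (ampExponent x (slotRelay hK m) + ampExponent x (slotRelay hK m))

/-- The exponent of the squared norm of `linkGain`. -/
def linkExponent {K : ℕ} (hK : 0 < K) (x : Fin K ⊕ (Fin K ⊕ Fin K) → ℝ) (m : ℕ) : ℝ :=
  -x (.inr (.inr (prevRelay (slotRelay hK m)))) +
    (ampExponent x (prevRelay (slotRelay hK m)) + ampExponent x (prevRelay (slotRelay hK m)))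

/-- The exponent of the mutual information over `L` slots. -/
def rateExponent {K : ℕ} (hK : 0 < K) (L : ℕ) (x : Fin K ⊕ (Fin K ⊕ Fin K) → ℝ) : ℝ :=
  tropChain (inputExponent hK x) (outputExponent hK x) (linkExponent hK x) L 0 0
      (inputExponent hK x 0) -
    tropChain (fun _ => 0) (outputExponent hK x) (linkExponent hK x) L 0 0 0

/-- The power gains of all links. -/
noncomputable def powerGain {K : ℕ} (c : Gains K) : Fin K ⊕ (Fin K ⊕ Fin K) → ℝ :=
  Sum.elim (fun k => ‖c.h k‖ ^ 2) (Sum.elim (fun k => ‖c.g k‖ ^ 2) fun k => ‖c.i k‖ ^ 2)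

lemma continuous_ampExponent {K : ℕ} (k : Fin K) :
    Continuous fun x : Fin K ⊕ (Fin K ⊕ Fin K) → ℝ => ampExponent x k := by
  unfold ampExponent; fun_prop

lemma continuous_rateExponent {K : ℕ} (hK : 0 < K) (L : ℕ) : Continuous (rateExponent hK L) := by
  have h1 : ∀ m, Continuous fun x => inputExponent hK x m := fun m => by
    unfold inputExponent; fun_prop
  have h2 : ∀ m, Continuous fun x => outputExponent hK x m := fun m => by
    have := continuous_ampExponent (slotRelay hK m)
    unfold outputExponent; fun_prop
  have h3 : ∀ m, Continuous fun x => linkExponent hK x m := fun m => by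
    have := continuous_ampExponent (prevRelay (slotRelay hK m))
    unfold linkExponent; fun_prop
  exact (continuous_tropChain h1 h2 h3 continuous_const (h1 0) L 0).sub
    (continuous_tropChain (fun _ => continuous_const) h2 h3 continuous_const continuous_const L 0)

section Exponents

variable {K : ℕ} {x : Fin K ⊕ (Fin K ⊕ Fin K) → ℝ}

lemma ampExponent_eq_zero (hx : ∀ j, 0 ≤ x j) (k : Fin K) : ampExponent x k = 0 := by
  have h1 := hx (.inl k)
  have h2 := hx (.inr (.inr (prevRelay k)))
  refine min_eq_left (sub_nonneg.2 (max_le (max_le ?_ ?_) zero_le_one)) <;> linarith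

lemma outputExponent_eq (hK : 0 < K) (hx : ∀ j, 0 ≤ x j) (m : ℕ) :
    outputExponent hK x m = -x (.inr (.inl (slotRelay hK m))) := by
  simp [outputExponent, ampExponent_eq_zero hx]

lemma linkExponent_eq (hK : 0 < K) (hx : ∀ j, 0 ≤ x j) (m : ℕ) :
    linkExponent hK x m = -x (.inr (.inr (prevRelay (slotRelay hK m)))) := by
  simp [linkExponent, ampExponent_eq_zero hx]

lemma rateExponent_add_smul_le (hK : 0 < K) (L : ℕ) (hx : ∀ j, 0 ≤ x j) {δ : ℝ} (hδ : 0 ≤ δ) :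
    rateExponent hK L (x + δ • Sum.elim (fun _ => 1) fun _ => 0) ≤ max 0 (rateExponent hK L x - δ) := by
  set y := x + δ • (Sum.elim (fun _ => 1) fun _ => 0 : Fin K ⊕ (Fin K ⊕ Fin K) → ℝ) with hy
  have hy0 : ∀ j, 0 ≤ y j := fun j => by
    rcases j with k | k
    · simpa [hy] using add_nonneg (hx _) hδ
    · simpa [hy] using hx _
  have ho : outputExponent hK y = outputExponent hK x := by
    ext m; rw [outputExponent_eq hK hx, outputExponent_eq hK hy0]; simp [hy]
  have hl : linkExponent hK y = linkExponent hK x := by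
    ext m; rw [linkExponent_eq hK hx, linkExponent_eq hK hy0]; simp [hy]
  have hin : ∀ m, inputExponent hK y m ≤ max 0 (inputExponent hK x m - δ) := fun m => by
    refine max_le_max le_rfl ?_
    have := le_max_right 0 (1 - x (.inl (slotRelay hK m)))
    simp only [inputExponent, hy, Pi.add_apply, Pi.smul_apply, Sum.elim_inl, smul_eq_mul,
      mul_one]
    linarith
  have hin' : inputExponent hK y 0 ≤ inputExponent hK x 0 :=
    (hin 0).trans (max_le (le_max_left _ _) (by linarith))
  have key := tropChain_shift (Λ := inputExponent hK x) (γ := outputExponent hK x) (β := linkExponent hK x)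
    (fun m => le_max_left _ _) hin hδ L 0 (u := 0) (u' := 0) (u₀ := 0) (v₀ := 0) (le_max_left _ _)
    (hin 0) le_rfl hin'
  rw [rateExponent, rateExponent, ho, hl]
  rcases le_max_iff.1 key with h | h
  · exact le_max_of_le_left (by linarith)
  · exact le_max_of_le_right (by linarith)

lemma sum_range_slotRelay (hK : 0 < K) (N : ℕ) (f : Fin K → ℝ) :
    ∑ j ∈ Finset.range (N * K), f (slotRelay hK j) = N * ∑ k, f k := by
  rw [Finset.sum_range]
  calc ∑ j : Fin (N * K), f (slotRelay hK j) = ∑ p : Fin N × Fin K, f p.2 :=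
        Fintype.sum_equiv finProdFinEquiv.symm _ _ fun j => rfl
    _ = N * ∑ k, f k := by simp [Fintype.sum_prod_type]

/-- The rate of the `K N` parallel two-hop paths, without interference between them. -/
lemma le_rateExponent (hK : 0 < K) (N : ℕ) (hx : ∀ j, 0 ≤ x j) :
    N * ∑ k : Fin K, (1 - x (.inl k) - x (.inr (.inl k))) ≤ rateExponent hK (N * K) x := by
  have h1 := add_sum_le_tropChain (inputExponent hK x) (outputExponent hK x) (linkExponent hK x)
    (N * K) 0 (u := 0) (v := inputExponent hK x 0) (by simp)
  have h2 : tropChain (fun _ => 0) (outputExponent hK x) (linkExponent hK x) (N * K) 0 0 0 ≤ 0 := by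
    refine tropChain_zero_nonpos (fun m => ?_) (fun m => ?_) _ _ le_rfl le_rfl
    · rw [outputExponent_eq hK hx]; linarith [hx (.inr (.inl (slotRelay hK m)))]
    · rw [linkExponent_eq hK hx]; linarith [hx (.inr (.inr (prevRelay (slotRelay hK m))))]
  rw [← sum_range_slotRelay hK N fun k => 1 - x (.inl k) - x (.inr (.inl k))]
  have h3 : ∑ j ∈ Finset.range (N * K),
      (1 - x (.inl (slotRelay hK j)) - x (.inr (.inl (slotRelay hK j))))
      ≤ ∑ j ∈ Finset.range (N * K), (outputExponent hK x (0 + j) + inputExponent hK x (0 + j)) := by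
    refine Finset.sum_le_sum fun j _ => ?_
    rw [zero_add, outputExponent_eq hK hx]
    have := le_max_right 0 (1 - x (.inl (slotRelay hK j)))
    rw [inputExponent]
    linarith
  rw [rateExponent]
  linarith

lemma log_eq_mul_gainExponent {ι : Type*} {P : ℝ} (hP : 1 < P) (z : ι → ℝ) (j : ι) :
    Real.log (z j) = Real.log P * -gainExponent P z j := by
  have := Real.log_pos hP
  rw [gainExponent]
  field_simp

lemma log_mul_eq_gainExponent {ι : Type*} {P : ℝ} (hP : 1 < P) {z : ι → ℝ} {j : ι} (hz : 0 < z j) :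
    Real.log (P * z j) = Real.log P * (1 - gainExponent P z j) := by
  rw [Real.log_mul (by linarith) hz.ne', log_eq_mul_gainExponent hP]
  ring

lemma log_one_add_mul_approx {ι : Type*} {P : ℝ} (hP : 1 < P) {z : ι → ℝ} {j : ι} (hz : 0 < z j) :
    |Real.log (1 + P * z j) - Real.log P * max 0 (1 - gainExponent P z j)| ≤ Real.log 2 := by
  have := log_add_approx (a := 1) (b := P * z j) (s := 0) (t := 1 - gainExponent P z j) (C := 0)
    one_pos (by positivity)
    (Real.log_pos hP).le (by simp) (by rw [log_mul_eq_gainExponent hP hz]; simp)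
  simpa using this

lemma log_amplification_approx (c : Gains K) {P : ℝ} (hP : 1 < P) (hc : ∀ j, 0 < powerGain c j)
    (k : Fin K) :
    |Real.log (amplification c P k) - Real.log P * ampExponent (gainExponent P (powerGain c)) k|
      ≤ 2 * Real.log 2 := by
  have hP0 : 0 < P := by linarith
  have hl := Real.log_pos hP
  have h1 : 0 < ‖c.h k‖ ^ 2 := hc (.inl k)
  have h2 : 0 < ‖c.i (prevRelay k)‖ ^ 2 := hc (.inr (.inr (prevRelay k)))
  set X := gainExponent P (powerGain c)
  have e1 : Real.log (P * ‖c.h k‖ ^ 2) = Real.log P * (1 - X (.inl k)) :=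
    log_mul_eq_gainExponent hP (hc (.inl k))
  have e2 : Real.log (P * ‖c.i (prevRelay k)‖ ^ 2)
      = Real.log P * (1 - X (.inr (.inr (prevRelay k)))) :=
    log_mul_eq_gainExponent hP (hc (.inr (.inr (prevRelay k))))
  have a1 := log_add_approx (s := 1 - X (.inl k)) (t := 1 - X (.inr (.inr (prevRelay k))))
    (C := 0) (mul_pos hP0 h1) (mul_pos hP0 h2) hl.le
    (by rw [e1]; simp) (by rw [e2]; simp)
  have a2 := log_add_approx (b := 1) (t := 0) (C := Real.log 2) (by positivity) one_pos hl.le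
    (a1.trans (by simp)) (by simp [Real.log_nonneg])
  rw [← mul_add] at a2
  set D := P * (‖c.h k‖ ^ 2 + ‖c.i (prevRelay k)‖ ^ 2) + 1
  have hD : 0 < D := by positivity
  have e3 : Real.log (amplification c P k) = min 0 (Real.log P - Real.log D) := by
    rw [amplification, Real.strictMonoOn_log.monotoneOn.map_min (by simp) (by simpa using by positivity),
      Real.log_one, Real.log_div hP0.ne' hD.ne']
  rw [e3, ampExponent, mul_min_of_nonneg _ _ hl.le, mul_zero]
  refine (abs_min_sub_min_le_max _ _ _ _).trans (max_le (by simp [Real.log_nonneg]) ?_)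
  rw [show Real.log P - Real.log D - Real.log P * (1 - max (max (1 - X (.inl k))
    (1 - X (.inr (.inr (prevRelay k))))) 0) = -(Real.log D - Real.log P * max (max (1 - X (.inl k))
    (1 - X (.inr (.inr (prevRelay k))))) 0) by ring, abs_neg]
  linarith

lemma amplification_pos (c : Gains K) {P : ℝ} (hP : 0 < P) (k : Fin K) : 0 < amplification c P k :=
  lt_min one_pos (by positivity)

/-- The squared norm of an amplified gain, on the logarithmic scale. -/
lemma log_norm_mul_amplification_approx (c : Gains K) {P : ℝ} (hP : 1 < P)
    (hc : ∀ j, 0 < powerGain c j) (k : Fin K) {w : ℂ} {j : Fin K ⊕ (Fin K ⊕ Fin K)}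
    (hw : ‖w‖ ^ 2 = powerGain c j) :
    0 < ‖w * (amplification c P k : ℂ)‖ ^ 2 ∧
    |Real.log (‖w * (amplification c P k : ℂ)‖ ^ 2) - Real.log P *
      (-gainExponent P (powerGain c) j + (ampExponent (gainExponent P (powerGain c)) k
        + ampExponent (gainExponent P (powerGain c)) k))| ≤ 4 * Real.log 2 := by
  have hα := amplification_pos c (P := P) (by linarith) k
  have e : ‖w * (amplification c P k : ℂ)‖ ^ 2
      = powerGain c j * (amplification c P k * amplification c P k) := by
    rw [norm_mul, mul_pow, hw, Complex.norm_real, Real.norm_of_nonneg hα.le]; ring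
  have h1 := log_amplification_approx c hP hc k
  rw [e]
  refine ⟨mul_pos (hc j) (mul_pos hα hα), (log_mul_approx (C := 0) (hc j) (mul_pos hα hα)
    (by rw [log_eq_mul_gainExponent hP]; simp) (log_mul_approx hα hα h1 h1)).trans (by linarith)⟩

/-- The mutual information is `log P` times its exponent, up to a bounded error. -/
lemma mutualInformation_approx (hK : 0 < K) (N : ℕ) (c : Gains K) {P : ℝ} (hP : 1 < P)
    (hc : ∀ j, 0 < powerGain c j) :
    |mutualInformation N c P
        - Real.log P * rateExponent hK (N * K) (gainExponent P (powerGain c))|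
      ≤ 2 * (4 * Real.log 2 + ((N * K : ℕ) : ℝ) * (2 * (4 * Real.log 2) + 2 * Real.log 2)) := by
  have hP0 : 0 < P := by linarith
  have hl := Real.log_pos hP
  have hl2 := Real.log_pos one_lt_two
  set X := gainExponent P (powerGain c)
  have hΛ : ∀ m, 0 < inputVar hK c P m := fun m => by unfold inputVar; positivity
  have hΛ' : ∀ m, |Real.log (inputVar hK c P m) - Real.log P * inputExponent hK X m|
      ≤ 4 * Real.log 2 := fun m =>
    (log_one_add_mul_approx hP (hc (.inl (slotRelay hK m)))).trans (by linarith)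
  have hγ := fun m => log_norm_mul_amplification_approx c hP hc (slotRelay hK m)
    (w := c.g (slotRelay hK m)) (j := .inr (.inl (slotRelay hK m))) rfl
  have hβ := fun m => log_norm_mul_amplification_approx c hP hc (prevRelay (slotRelay hK m))
    (w := c.i (prevRelay (slotRelay hK m))) (j := .inr (.inr (prevRelay (slotRelay hK m)))) rfl
  have hnum := log_chain_approx (Λ := inputVar hK c P) (γ := fun j => ‖outputGain hK c P j‖ ^ 2)
    (β := fun j => ‖linkGain hK c P j‖ ^ 2) (Λ' := inputExponent hK X)
    (γ' := outputExponent hK X) (β' := linkExponent hK X) hl.le hΛ (fun m => (hγ m).1)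
    (fun m => (hβ m).1) hΛ' (fun m => (hγ m).2) (fun m => (hβ m).2) (N * K) 0 (u := 1) (u' := 0)
    (D := 4 * Real.log 2) one_pos (hΛ 0) (by simpa using hl2.le) (hΛ' 0)
  have hden := log_chain_approx (Λ := fun _ => 1) (γ := fun j => ‖outputGain hK c P j‖ ^ 2)
    (β := fun j => ‖linkGain hK c P j‖ ^ 2) (Λ' := fun _ => 0)
    (γ' := outputExponent hK X) (β' := linkExponent hK X) hl.le (fun _ => one_pos)
    (fun m => (hγ m).1) (fun m => (hβ m).1) (fun _ => by simpa using hl2.le) (fun m => (hγ m).2)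
    (fun m => (hβ m).2) (N * K) 0 (u := 1) (u' := 0) (v := 1) (v' := 0)
    (D := 4 * Real.log 2) one_pos one_pos (by simpa using hl2.le) (by simpa using hl2.le)
  have hpos : ∀ {Λ : ℕ → ℝ}, (∀ m, 0 < Λ m) → 0 < chain Λ (fun j => ‖outputGain hK c P j‖ ^ 2)
      (fun j => ‖linkGain hK c P j‖ ^ 2) (N * K) 0 1 (Λ 0) := fun h =>
    zero_lt_one.trans_le (le_chain (fun m => (h m).le) (fun _ => by positivity)
      (fun _ => by positivity) _ _ zero_le_one (h 0).le)
  rw [mutualInformation_eq hK c hP0.le, Real.log_div (hpos hΛ).ne' (hpos fun _ => one_pos).ne',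
    rateExponent]
  rw [abs_le] at hnum hden ⊢
  constructor <;> linarith [hnum.1, hnum.2, hden.1, hden.2]

/-- The mutual information is at most that of `N K` uses of the cut. -/
lemma mutualInformation_le (hK : 0 < K) (N : ℕ) (c : Gains K) {P : ℝ} (hP : 0 < P) :
    mutualInformation N c P ≤ (N * K : ℕ) * Real.log (1 + P * ∑ k, ‖c.h k‖ ^ 2) := by
  set S := 1 + P * ∑ k, ‖c.h k‖ ^ 2
  have hS : 1 ≤ S := le_add_of_nonneg_right (by positivity)
  have hΛ : ∀ m, 0 ≤ inputVar hK c P m := fun m => by unfold inputVar; positivity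
  have hΛS : ∀ m, inputVar hK c P m ≤ S := fun m => by
    have := Finset.single_le_sum (f := fun k => ‖c.h k‖ ^ 2) (fun k _ => by positivity)
      (Finset.mem_univ (slotRelay hK m))
    exact add_le_add le_rfl (mul_le_mul_of_nonneg_left this hP.le)
  have hγ : ∀ m, 0 ≤ ‖outputGain hK c P m‖ ^ 2 := fun m => by positivity
  have hβ : ∀ m, 0 ≤ ‖linkGain hK c P m‖ ^ 2 := fun m => by positivity
  have h1 : 1 ≤ chain (fun _ => 1) (fun j => ‖outputGain hK c P j‖ ^ 2)
      (fun j => ‖linkGain hK c P j‖ ^ 2) (N * K) 0 1 1 :=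
    le_chain (fun _ => zero_le_one) hγ hβ _ _ zero_le_one zero_le_one
  have h2 : 1 ≤ chain (inputVar hK c P) (fun j => ‖outputGain hK c P j‖ ^ 2)
      (fun j => ‖linkGain hK c P j‖ ^ 2) (N * K) 0 1 (inputVar hK c P 0) :=
    le_chain hΛ hγ hβ _ _ zero_le_one (hΛ 0)
  rw [mutualInformation_eq hK c hP.le, ← Real.log_pow]
  refine Real.log_le_log (by positivity) ((div_le_iff₀ (by positivity)).2 ?_)
  refine le_trans ?_ (chain_le_pow_mul hS hΛ hΛS hγ hβ (N * K) 0 zero_le_one zero_le_one)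
  exact chain_mono hΛ (fun _ => le_rfl) hγ hβ _ _ zero_le_one (hΛ 0) le_rfl (by simpa using hΛS 0)

lemma mutualInformation_pos (hK : 0 < K) {N : ℕ} (hN : 0 < N) (c : Gains K) {P : ℝ} (hP : 0 < P)
    (hc : ∀ j, 0 < powerGain c j) : 0 < mutualInformation N c P := by
  have hα := amplification_pos c hP
  have hΛ : ∀ m, 1 < inputVar hK c P m := fun m =>
    lt_add_of_pos_right _ (mul_pos hP (hc (.inl (slotRelay hK m))))
  have hγ : ∀ m, 0 < ‖outputGain hK c P m‖ ^ 2 := fun m => by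
    have h1 : 0 < ‖c.g (slotRelay hK m)‖ ^ 2 := hc (.inr (.inl (slotRelay hK m)))
    rw [outputGain, norm_mul, mul_pow, Complex.norm_real, Real.norm_of_nonneg (hα _).le]
    exact mul_pos h1 (pow_pos (hα _) 2)
  have hβ : ∀ m, 0 ≤ ‖linkGain hK c P m‖ ^ 2 := fun m => by positivity
  have h1 : 1 ≤ chain (fun _ => 1) (fun j => ‖outputGain hK c P j‖ ^ 2)
      (fun j => ‖linkGain hK c P j‖ ^ 2) (N * K) 0 1 1 :=
    le_chain (fun _ => zero_le_one) (fun m => (hγ m).le) hβ _ _ zero_le_one zero_le_one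
  rw [mutualInformation_eq hK c hP.le]
  exact Real.log_pos ((one_lt_div (by positivity)).2 (chain_one_lt hΛ hγ hβ (Nat.mul_pos hN hK)))

end Exponents

/-! ### The cut between the transmitter and the relays -/

/-- The exponent of the capacity of the cut between the transmitter and the relays. -/
noncomputable def cutExponent {K : ℕ} (hK : 0 < K) (x : Fin K → ℝ) : ℝ :=
  max 0 (Finset.univ.sup' ⟨⟨0, hK⟩, Finset.mem_univ _⟩ fun k => 1 - x k)

section Cut

variable {K : ℕ} (hK : 0 < K)

lemma continuous_cutExponent : Continuous (cutExponent hK) :=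
  continuous_const.max (Continuous.finset_sup'_apply _ fun k _ => by fun_prop)

lemma one_sub_le_cutExponent (x : Fin K → ℝ) (k : Fin K) : 1 - x k ≤ cutExponent hK x :=
  le_max_of_le_right (Finset.le_sup' (fun k => 1 - x k) (Finset.mem_univ k))

lemma cutExponent_le {x : Fin K → ℝ} {c : ℝ} (hc : 0 ≤ c) (h : ∀ k, 1 - x k ≤ c) :
    cutExponent hK x ≤ c :=
  max_le hc (Finset.sup'_le _ _ fun k _ => h k)

lemma cutExponent_add_smul_le (x : Fin K → ℝ) (δ : ℝ) :
    cutExponent hK (x + δ • fun _ => 1) ≤ max 0 (cutExponent hK x - δ) := by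
  refine cutExponent_le hK (le_max_left _ _) fun k => le_max_of_le_right ?_
  have := one_sub_le_cutExponent hK x k
  simp only [Pi.add_apply, Pi.smul_apply, smul_eq_mul, mul_one]
  linarith

lemma log_cut_approx {P : ℝ} (hP : 1 < P) {z : Fin K → ℝ} (hz : ∀ k, 0 < z k) :
    |Real.log (1 + P * ∑ k, z k) - Real.log P * cutExponent hK (gainExponent P z)|
      ≤ Real.log K + Real.log 2 := by
  have hP0 : 0 < P := by linarith
  have hl := Real.log_pos hP
  have hK1 : (1 : ℝ) ≤ K := by exact_mod_cast hK
  obtain ⟨k, -, hk⟩ := Finset.exists_max_image Finset.univ z ⟨⟨0, hK⟩, Finset.mem_univ _⟩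
  have hφ : cutExponent hK (gainExponent P z) = max 0 (1 - gainExponent P z k) := by
    refine le_antisymm (cutExponent_le hK (le_max_left _ _) fun l => le_max_of_le_right ?_)
      (max_le (le_max_left _ _) (one_sub_le_cutExponent hK _ k))
    have := Real.log_le_log (hz l) (hk l (Finset.mem_univ l))
    refine sub_le_sub_left ?_ _
    exact div_le_div_of_nonneg_right (neg_le_neg this) hl.le
  have h1 := log_one_add_mul_approx hP (hz k)
  have h2 : Real.log (1 + P * z k) ≤ Real.log (1 + P * ∑ k, z k) := by
    have := hz k
    have h3 := Finset.single_le_sum (f := z) (fun k _ => (hz k).le) (Finset.mem_univ k)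
    exact Real.log_le_log (by positivity) (by gcongr)
  have h3 : Real.log (1 + P * ∑ k, z k) ≤ Real.log K + Real.log (1 + P * z k) := by
    have h4 : 0 ≤ ∑ k, z k := Finset.sum_nonneg fun k _ => (hz k).le
    have h5 : ∑ l, z l ≤ K * z k := by
      simpa using Finset.sum_le_card_nsmul Finset.univ z (z k) fun l hl => hk l hl
    have := hz k
    rw [← Real.log_mul (by positivity) (by positivity)]
    refine Real.log_le_log (by positivity) ?_
    nlinarith [mul_le_mul_of_nonneg_left h5 hP0.le]
  rw [hφ]
  have h6 := Real.log_nonneg hK1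
  rw [abs_le] at h1 ⊢
  constructor <;> linarith [h1.1, h1.2]

lemma sInf_cutExponent {r : ℝ} (hr : 0 ≤ r) :
    sInf {t | ∃ x : Fin K → ℝ, (∀ k, 0 ≤ x k) ∧ cutExponent hK x ≤ r ∧ t = ∑ k, x k}
      = K * max 0 (1 - r) := by
  refine IsLeast.csInf_eq ⟨⟨fun _ => max 0 (1 - r), fun _ => le_max_left _ _,
    cutExponent_le hK hr fun k => ?_, by simp⟩, ?_⟩
  · linarith [le_max_right 0 (1 - r)]
  · rintro t ⟨x, hx, hxr, rfl⟩
    have : ∀ k ∈ Finset.univ, max 0 (1 - r) ≤ x k := fun k _ =>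
      max_le (hx k) (by linarith [one_sub_le_cutExponent hK x k])
    simpa using Finset.card_nsmul_le_sum Finset.univ x (max 0 (1 - r)) this

end Cut

/-! ### Diversity gains -/

lemma hasDiversityGain_top {p : ℝ → ℝ≥0∞} (h : ∀ P, 1 < P → p P = 0) : HasDiversityGain p ⊤ := by
  refine tendsto_const_nhds.congr' ?_
  filter_upwards [eventually_gt_atTop 1] with P hP
  have hl := Real.log_pos hP
  rw [h P hP, ENNReal.log_zero, EReal.neg_bot,
    EReal.top_div_of_pos_ne_top (by exact_mod_cast hl) (EReal.coe_ne_top _)]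

lemma HasDiversityGain.le_of_le {p q : ℝ → ℝ≥0∞} {d d' : EReal} (hp : HasDiversityGain p d)
    (hq : HasDiversityGain q d') (h : ∀ P, 1 < P → q P ≤ p P) : d ≤ d' := by
  refine le_of_tendsto_of_tendsto hp hq ?_
  filter_upwards [eventually_gt_atTop 1] with P hP
  exact EReal.div_le_div_right_of_nonneg (by exact_mod_cast (Real.log_pos hP).le)
    (EReal.neg_le_neg_iff.2 (ENNReal.log_le_log (h P hP)))

lemma isFadingLaw_sq_norm {Ω : Type*} [MeasurableSpace Ω] {μ : Measure Ω} {X : Ω → ℂ} {v : ℝ≥0}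
    (hv : 0 < v) (hX : HasLaw X (complexNormal v) μ) :
    AEMeasurable (fun ω => ‖X ω‖ ^ 2) μ ∧ IsFadingLaw (μ.map fun ω => ‖X ω‖ ^ 2) := by
  have h : HasLaw (fun ω => ‖X ω‖ ^ 2) ((complexNormal v).map fun z => ‖z‖ ^ 2) μ :=
    HasLaw.fun_comp (Y := fun z : ℂ => ‖z‖ ^ 2)
      ⟨by fun_prop, rfl⟩ hX
  exact ⟨h.aemeasurable, h.map_eq ▸ isFadingLaw_complexNormal hv⟩

section Scheme

variable {Ω : Type*} [MeasurableSpace Ω] {μ : Measure Ω} {K : ℕ} {h g i : Fin K → Ω → ℂ}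

/-- The diversity gain of the scheme for positive multiplexing gain: the least sum of nonnegative
exponents of the power gains for which the scheme is in outage. -/
noncomputable def schemeDiversity (hK : 0 < K) (N : ℕ) (r : ℝ) : ℝ :=
  sInf {t | ∃ x : Fin K ⊕ (Fin K ⊕ Fin K) → ℝ, (∀ j, 0 ≤ x j) ∧
    rateExponent hK (N * K) x ≤ ((N * K : ℕ) + 1 : ℝ) * r ∧ t = ∑ j, x j}

lemma le_schemeDiversity (hK : 0 < K) {N : ℕ} (hN : 1 ≤ N) {r : ℝ} (hr : 0 ≤ r) :
    max 0 (K * (1 - r) - r / N) ≤ schemeDiversity hK N r := by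
  have hN0 : (0 : ℝ) < N := by exact_mod_cast hN
  refine max_le (Real.sInf_nonneg ?_) ?_
  · rintro t ⟨x, hx, -, rfl⟩
    exact Finset.sum_nonneg fun j _ => hx j
  refine le_csInf ?_ ?_
  · -- the infimum is over a nonempty set, as large exponents of the first hop give rate zero
    have h0 := rateExponent_add_smul_le hK (N * K) (x := 0) (fun _ => le_rfl)
      (le_max_left 0 (rateExponent hK (N * K) 0))
    refine ⟨_, _, fun j => ?_, h0.trans (max_le (by positivity) ?_), rfl⟩
    · rcases j with k | k <;> simp
    · refine le_trans ?_ (by positivity : 0 ≤ ((N * K : ℕ) + 1 : ℝ) * r)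
      linarith [le_max_right 0 (rateExponent hK (N * K) 0)]
  · rintro t ⟨x, hx, hxr, rfl⟩
    have h1 := (le_rateExponent hK N hx).trans hxr
    simp only [Finset.sum_sub_distrib, Finset.sum_const, Finset.card_univ, Fintype.card_fin,
      nsmul_eq_mul, mul_one] at h1
    push_cast at h1
    have h2 : 0 ≤ ∑ k, x (.inr (.inr k)) := Finset.sum_nonneg fun k _ => hx _
    rw [Fintype.sum_sum_type, Fintype.sum_sum_type]
    have h3 : (K : ℝ) * (1 - r) - r / N
        = (N * K - (N * K + 1) * r) / N := by field_simp; ring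
    have h4 : (K : ℝ) * (1 - r) - r / N
        ≤ ∑ k, x (.inl k) + ∑ k, x (.inr (.inl k)) := by
      rw [h3, div_le_iff₀ hN0]
      linarith
    linarith

lemma powerGain_gainsAt {Ω : Type*} {h g i : Fin K → Ω → ℂ} (ω : Ω) (j : Fin K ⊕ (Fin K ⊕ Fin K)) :
    powerGain (gainsAt h g i ω) j = ‖Sum.elim h (Sum.elim g i) j ω‖ ^ 2 := by
  rcases j with k | k | k <;> rfl

lemma cutSetOutageProbability_le_outageProbability (hK : 0 < K) (N : ℕ) {r : ℝ} (hr : 0 ≤ r) {P : ℝ}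
    (hP : 1 < P) : cutSetOutageProbability μ h r P ≤ outageProbability μ h g i N r P := by
  refine measure_mono fun ω hω => ?_
  have hω' : Real.log (1 + P * ∑ k, ‖h k ω‖ ^ 2) ≤ r * Real.log P := hω
  have h1 := mutualInformation_le hK N (gainsAt h g i ω) (zero_lt_one.trans hP)
  have h2 := mul_le_mul_of_nonneg_left hω' (Nat.cast_nonneg (α := ℝ) (N * K))
  have h3 := mul_nonneg hr (Real.log_pos hP).le
  show mutualInformation N (gainsAt h g i ω) P ≤ _
  refine h1.trans (h2.trans ?_)
  rw [mul_assoc, add_mul, one_mul]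
  linarith

variable [IsProbabilityMeasure μ] {vh : Fin K → ℝ≥0}

/-- The diversity gain of the scheme. For multiplexing gain `0` an outage has probability `0`. -/
lemma hasDiversityGain_scheme (hK : 0 < K) {w : Fin K ⊕ (Fin K ⊕ Fin K) → ℝ≥0} (hw : ∀ j, 0 < w j)
    (hlaw : ∀ j, HasLaw (Sum.elim h (Sum.elim g i) j) (complexNormal (w j)) μ)
    (hind : iIndepFun (Sum.elim h (Sum.elim g i)) μ) {N : ℕ} (hN : 1 ≤ N) {r : ℝ} (hr : 0 ≤ r) :
    HasDiversityGain (outageProbability μ h g i N r)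
      (if r = 0 then ⊤ else (schemeDiversity hK N r : EReal)) := by
  set Z : Fin K ⊕ (Fin K ⊕ Fin K) → Ω → ℝ := fun j ω => ‖Sum.elim h (Sum.elim g i) j ω‖ ^ 2 
  have hZ : ∀ j, AEMeasurable (Z j) μ := fun j => (isFadingLaw_sq_norm (hw j) (hlaw j)).1
  have hZlaw : ∀ j, IsFadingLaw (μ.map (Z j)) := fun j => (isFadingLaw_sq_norm (hw j) (hlaw j)).2
  have hZind : iIndepFun Z μ :=
    hind.comp (fun _ (z : ℂ) => ‖z‖ ^ 2) fun _ => by fun_prop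
  have hgain : ∀ ω, powerGain (gainsAt h g i ω) = fun j => Z j ω :=
    fun ω => funext fun j => powerGain_gainsAt ω j
  split_ifs with h0
  · subst h0
    refine hasDiversityGain_top fun P hP => ?_
    refine measure_mono_null (fun ω hω => ?_) (ae_iff.1 (ae_forall_pos hZ hZlaw))
    refine fun hpos => ?_
    have hω' : mutualInformation N (gainsAt h g i ω) P ≤ ((N * K : ℕ) + 1 : ℝ) * 0 * Real.log P := hω
    have := mutualInformation_pos hK hN (gainsAt h g i ω) (zero_lt_one.trans hP)
      fun j => by rw [hgain]; exact hpos j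
    rw [mul_zero, zero_mul] at hω'
    linarith
  · have hr0 : 0 < r := lt_of_le_of_ne hr (Ne.symm h0)
    have happrox := fun (P : ℝ) (ω : Ω) (hP : 1 < P) (hpos : ∀ j, 0 < Z j ω) =>
      mutualInformation_approx hK N (gainsAt h g i ω) hP fun j => by rw [hgain]; exact hpos j
    simp only [hgain] at happrox
    exact hasDiversityGain_sInf hZ hZlaw hZind (continuous_rateExponent hK (N * K)) happrox
      (e := Sum.elim (fun _ => 1) fun _ => 0) (fun j => by rcases j with k | k <;> simp)
      (fun x hx δ hδ => rateExponent_add_smul_le hK (N * K) hx hδ) (by positivity)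

/-- The diversity gain of the cut. For multiplexing gain `0` an outage has probability `0`. -/
lemma hasDiversityGain_cut (hK : 0 < K) (hvh : ∀ k, 0 < vh k)
    (hh : ∀ k, HasLaw (h k) (complexNormal (vh k)) μ) (hind : iIndepFun h μ) {r : ℝ} (hr : 0 ≤ r) :
    HasDiversityGain (cutSetOutageProbability μ h r)
      (if r = 0 then ⊤ else ((K * max 0 (1 - r) : ℝ) : EReal)) := by
  set Z : Fin K → Ω → ℝ := fun k ω => ‖h k ω‖ ^ 2
  have hZ : ∀ j, AEMeasurable (Z j) μ := fun j => (isFadingLaw_sq_norm (hvh j) (hh j)).1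
  have hZlaw : ∀ j, IsFadingLaw (μ.map (Z j)) := fun j => (isFadingLaw_sq_norm (hvh j) (hh j)).2
  have hZind : iIndepFun Z μ := hind.comp (fun _ (z : ℂ) => ‖z‖ ^ 2) fun _ => by fun_prop
  split_ifs with h0
  · subst h0
    refine hasDiversityGain_top fun P hP => ?_
    refine measure_mono_null (fun ω hω => ?_) (ae_iff.1 (ae_forall_pos hZ hZlaw))
    refine fun hpos => ?_
    have hω' : Real.log (1 + P * ∑ k, ‖h k ω‖ ^ 2) ≤ 0 * Real.log P := hω
    have h1 : 0 < ∑ k, Z k ω := Finset.sum_pos (fun k _ => hpos k) ⟨⟨0, hK⟩, Finset.mem_univ _⟩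
    have h2 := Real.log_pos (lt_add_of_pos_right 1 (mul_pos (zero_lt_one.trans hP) h1))
    rw [zero_mul] at hω'
    exact absurd hω' (not_le.2 h2)
  · have hr0 : 0 < r := lt_of_le_of_ne hr (Ne.symm h0)
    rw [← sInf_cutExponent hK hr]
    exact hasDiversityGain_sInf hZ hZlaw hZind (continuous_cutExponent hK)
      (f := fun P ω => Real.log (1 + P * ∑ k, ‖h k ω‖ ^ 2))
      (fun P ω hP hpos => log_cut_approx hK hP hpos) (e := fun _ => 1) (fun _ => zero_le_one)
      (fun x _ δ _ => cutExponent_add_smul_le hK x δ) hr0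

end Scheme

lemma tendsto_lower_bound (K r : ℝ) :
    Tendsto (fun N : ℕ => max 0 (K * (1 - r) - r / N)) atTop (𝓝 (max 0 (K * (1 - r)))) := by
  have := (tendsto_const_nhds (x := K * (1 - r))).sub (tendsto_const_div_atTop_nhds_zero_nat r)
  rw [sub_zero] at this
  exact tendsto_const_nhds.max this

theorem theorem2 {Ω : Type*} [MeasurableSpace Ω] (μ : Measure Ω) [IsProbabilityMeasure μ]
    (K : ℕ) (hK : 2 ≤ K) (h g i : Fin K → Ω → ℂ) (vh vg vi : Fin K → ℝ≥0)
    (hvh : ∀ k, 0 < vh k) (hvg : ∀ k, 0 < vg k) (hvi : ∀ k, 0 < vi k)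
    -- independent Rayleigh fading on all links
    (hh : ∀ k, HasLaw (h k) (complexNormal (vh k)) μ)
    (hg : ∀ k, HasLaw (g k) (complexNormal (vg k)) μ)
    (hi : ∀ k, HasLaw (i k) (complexNormal (vi k)) μ)
    (hind : iIndepFun (Sum.elim h (Sum.elim g i)) μ) :
    -- the scheme, for all gains and all powers
    (∀ (N : ℕ) (c : Gains K) (P : ℝ), 1 ≤ N → 0 < P →
      -- half-duplex: a relay is silent in its listening slots
      (∀ (x n : Fin (N * K) → ℂ) (s : ℕ) (k : Fin K), s % K = k.val →
        relaySignal c P x n s k = 0) ∧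
      -- the relays meet the power constraint for a Gaussian codebook of power `P`
      (∀ (s : ℕ) (k : Fin K),
        ∫⁻ w, ‖relaySignal c P w.1 w.2 s k‖ₑ ^ 2
          ∂((iidNormal (N * K) P.toNNReal).prod (iidNormal (N * K) 1)) ≤ ENNReal.ofReal P) ∧
      -- the end-to-end channel is a lower triangular MIMO channel
      (∀ x n z : Fin (N * K) → ℂ,
        receiverSignal c P x n z = channelMatrix N c P *ᵥ x + (relayMatrix N c P *ᵥ n + z)) ∧
      (∀ a b : Fin (N * K), a < b → channelMatrix N c P a b = 0) ∧
      -- whose noise is coloured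
      (∀ a b : Fin (N * K),
        Integrable (fun w : (Fin (N * K) → ℂ) × (Fin (N * K) → ℂ) =>
          (relayMatrix N c P *ᵥ w.1 + w.2) a * star ((relayMatrix N c P *ᵥ w.1 + w.2) b))
          ((iidNormal (N * K) 1).prod (iidNormal (N * K) 1)) ∧
        ∫ w, (relayMatrix N c P *ᵥ w.1 + w.2) a * star ((relayMatrix N c P *ᵥ w.1 + w.2) b)
          ∂((iidNormal (N * K) 1).prod (iidNormal (N * K) 1)) = noiseCovariance N c P a b)) ∧
    -- the diversity gain of the scheme, and the optimal (cut-set) one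
    (∃ (dSM : ℕ → ℝ → EReal) (dOpt : ℝ → EReal),
      (∀ (N : ℕ) (r : ℝ), 1 ≤ N → 0 ≤ r →
        HasDiversityGain (outageProbability μ h g i N r) (dSM N r) ∧
        ((max 0 (K * (1 - r) - r / N) : ℝ) : EReal) ≤ dSM N r) ∧
      (∀ r : ℝ, 0 ≤ r → HasDiversityGain (cutSetOutageProbability μ h r) (dOpt r)) ∧
      (∀ (N : ℕ) (r : ℝ), 1 ≤ N → 0 ≤ r → dSM N r ≤ dOpt r) ∧
      (∀ r : ℝ, 0 < r → r ≤ 1 → dOpt r = ((K * (1 - r) : ℝ) : EReal)) ∧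
      (∀ r : ℝ, 0 ≤ r → Tendsto (fun N => dSM N r) atTop (𝓝 (dOpt r))) ∧
      (∀ r : ℝ, 0 ≤ r → r ≤ 1 →
        Tendsto (fun N : ℕ => max 0 (K * (1 - r) - r / N : ℝ)) atTop (𝓝 (K * (1 - r))))) := by
  have hK0 : 0 < K := by omega
  refine ⟨fun N c P hN hP => ⟨fun x n s k hsk => relaySignal_listening hK c P x n hsk,
    fun s k => lintegral_relaySignal_le c hP s k, receiverSignal_eq hK0 c P,
    fun a b hab => channelMatrix_lower hK0 c P hab,
    fun a b => ⟨integrable_noise _ a b, integral_noise _ a b⟩⟩, ?_⟩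
  have hw : ∀ j, 0 < Sum.elim vh (Sum.elim vg vi) j := by
    rintro (k | k | k)
    exacts [hvh k, hvg k, hvi k]
  have hlaw : ∀ j, HasLaw (Sum.elim h (Sum.elim g i) j)
      (complexNormal (Sum.elim vh (Sum.elim vg vi) j)) μ := by
    rintro (k | k | k)
    exacts [hh k, hg k, hi k]
  have hind_h : iIndepFun h μ := hind.precomp (g := Sum.inl) Sum.inl_injective
  have hscheme := fun {N : ℕ} (hN : 1 ≤ N) {r : ℝ} (hr : 0 ≤ r) =>
    hasDiversityGain_scheme hK0 hw hlaw hind hN hr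
  have hcut := fun {r : ℝ} (hr : 0 ≤ r) => hasDiversityGain_cut hK0 hvh hh hind_h hr
  have hle : ∀ (N : ℕ) (r : ℝ), 1 ≤ N → 0 ≤ r →
      (if r = 0 then ⊤ else (schemeDiversity hK0 N r : EReal))
        ≤ if r = 0 then ⊤ else ((K * max 0 (1 - r) : ℝ) : EReal) := fun N r hN hr =>
    (hscheme hN hr).le_of_le (hcut hr) fun P hP =>
      cutSetOutageProbability_le_outageProbability hK0 N hr hP
  have hmax : ∀ r : ℝ, (K : ℝ) * max 0 (1 - r) = max 0 (K * (1 - r)) := fun r => by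
    rw [mul_max_of_nonneg _ _ (Nat.cast_nonneg K), mul_zero]
  refine ⟨fun N r => if r = 0 then ⊤ else (schemeDiversity hK0 N r : EReal),
    fun r => if r = 0 then ⊤ else ((K * max 0 (1 - r) : ℝ) : EReal),
    fun N r hN hr => ⟨hscheme hN hr, ?_⟩, fun r hr => hcut hr, hle, fun r hr0 hr1 => ?_,
    fun r hr => ?_, fun r _ hr1 => ?_⟩
  · dsimp only
    split_ifs
    · exact le_top
    · exact_mod_cast le_schemeDiversity hK0 hN hr
  · dsimp only
    rw [if_neg hr0.ne', max_eq_right (by linarith)]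
  · by_cases h0 : r = 0
    · simp [h0]
    · have hlow : Tendsto (fun N : ℕ => ((max 0 (K * (1 - r) - r / N) : ℝ) : EReal)) atTop
          (𝓝 (if r = 0 then ⊤ else ((K * max 0 (1 - r) : ℝ) : EReal))) := by
        rw [if_neg h0, hmax]
        exact (continuous_coe_real_ereal.tendsto _).comp (tendsto_lower_bound K r)
      refine tendsto_of_tendsto_of_tendsto_of_le_of_le' hlow tendsto_const_nhds ?_ ?_
      · filter_upwards [eventually_ge_atTop 1] with N hN
        simp only [if_neg h0]
        exact_mod_cast le_schemeDiversity hK0 hN hr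
      · filter_upwards [eventually_ge_atTop 1] with N hN
        exact hle N r hN hr
  · have h1 : 0 ≤ (K : ℝ) * (1 - r) := mul_nonneg (Nat.cast_nonneg K) (by linarith)
    simpa only [max_eq_right h1] using tendsto_lower_bound K r
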